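/- Let $\Gamma\subset\mathbb C^2$ be a discrete subgroup of $\mathbb Z$-rank $3$ and let $T=\mathbb C^2/\Gamma$, a complex Lie group. An elliptic curve is a complex Lie group $E=\mathbb C/\Lambda$ with $\Lambda\subset\mathbb C$ a lattice of rank $2$; two elliptic curves $E_1,E_2$ are isogenous if there is a surjective holomorphic homomorphism $E_1\to E_2$ with finite kernel. Consider the following two conditions. (i) $T$ is isomorphic, as a complex Lie group, to $\mathbb C^*\times E$ for some elliptic curve $E$. (ii) There are a number field $k\subset\mathbb C$ of degree $3$ over $\mathbb Q$ and a $\mathbb C$-linear automorphism $A$ of $\mathbb C^2$ such that $A(\Gamma)\subset k^2$. Theorem. (a) Suppose that any two elliptic curves $E,E'$ which are quotients of $T$ by connected closed complex subgroups (that is, for which there are surjective holomorphic homomorphisms $T\to E$ and $T\to E'$ with connected kernels) are isogenous. Then (i) or (ii) holds. (b) Conversely, if (i) or (ii) holds, then there is an elliptic curve $E_0$ such that $E$ is isogenous to $E_0$ for every elliptic curve $E$ and every surjective holomorphic homomorphism $T\to E$, where, in case $T$ satisfies (i), only those homomorphisms are considered whose kernel has finitely many connected components (in particular all those with connected kernel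 are considered). (The restriction in (b) cannot be dropped: $\mathbb C^*\times E$ projects onto $\mathbb C^*$, which maps holomorphically and homomorphically onto every elliptic curve.) -/

import Mathlib

open scoped Manifold ContDiff

noncomputable section

namespace SemiTorus

/-- The projection `V → V / Γ` is a local homeomorphism if `Γ` is discrete. -/
theorem isLocalHomeomorph_mk {V : Type*} [NormedAddCommGroup V]
    (Γ : AddSubgroup V) [hΓ : DiscreteTopology Γ] :
    IsLocalHomeomorph (QuotientAddGroup.mk : V → V ⧸ Γ) :=
  (Γ.isAddQuotientCoveringMap_of_comm ⟨hΓ⟩).isCoveringMap.isLocalHomeomorph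

/-- The quotient of a complex vector space `V` by a discrete subgroup `Γ` as a complex manifold:
the charts are all the local inverses of the projection `V → V / Γ`. -/
instance quotientChartedSpace {V : Type*} [NormedAddCommGroup V]
    (Γ : AddSubgroup V) [DiscreteTopology Γ] : ChartedSpace V (V ⧸ Γ) where
  atlas := {c | ∃ e : OpenPartialHomeomorph V (V ⧸ Γ),
    (QuotientAddGroup.mk : V → V ⧸ Γ) = e ∧ c = e.symm}
  chartAt q := (isLocalHomeomorph_mk Γ).localInverseAt q.out
  mem_chart_source q := by
    have h := (isLocalHomeomorph_mk Γ).apply_self_mem_localInverseAt_source (x := q.out)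
    rwa [QuotientAddGroup.out_eq'] at h
  chart_mem_atlas q :=
    ⟨((isLocalHomeomorph_mk Γ).localInverseAt q.out).symm,
      ((isLocalHomeomorph_mk Γ).localInverseAt_symm q.out).symm, by simp⟩

/-- The charts above are holomorphically compatible: the changes of charts are locally
translations by elements of `Γ`. -/
instance quotientIsManifold {V : Type*} [NormedAddCommGroup V] [NormedSpace ℂ V]
    (Γ : AddSubgroup V) [DiscreteTopology Γ] :
    IsManifold 𝓘(ℂ, V) ω (V ⧸ Γ) := by
  apply isManifold_of_contDiffOn
  rintro _ _ ⟨e, he, rfl⟩ ⟨e', he', rfl⟩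
  simp only [modelWithCornersSelf_coe, modelWithCornersSelf_coe_symm, Set.range_id,
    Set.inter_univ, Set.preimage_id, Function.comp_id, Function.id_comp,
    OpenPartialHomeomorph.symm_symm]
  intro x hx
  set t := e.trans e'.symm with ht
  have hmem : ∀ y ∈ t.source, t y - y ∈ Γ := by
    intro y hy
    have h1 : e' (e'.symm (e y)) = e y := e'.right_inv (by simpa [ht] using hy.2)
    rw [← he', ← he] at h1
    have h2 := (QuotientAddGroup.eq (s := Γ)).1 h1.symm
    simpa [ht, ← he, sub_eq_neg_add] using h2
  have hcont : ContinuousOn (fun y => t y - y) t.source :=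
    t.continuousOn.sub continuousOn_id
  obtain ⟨U, hU, hU'⟩ : ∃ U ∈ nhds (t x - x), U ∩ (Γ : Set V) = {t x - x} := by
    exact nhds_inter_eq_singleton_of_mem_discrete ⟨inferInstance⟩ (hmem x hx)
  have hev : ∀ᶠ y in nhds x, t y = y + (t x - x) := by
    have h1 := (hcont.continuousAt (t.open_source.mem_nhds hx)).preimage_mem_nhds hU
    filter_upwards [h1, t.open_source.mem_nhds hx] with y hy hys
    have : t y - y ∈ U ∩ (Γ : Set V) := ⟨hy, hmem y hys⟩
    rw [hU'] at this
    rw [← Set.mem_singleton_iff.1 this]; abel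
  exact ((contDiffAt_id.add contDiffAt_const).congr_of_eventuallyEq hev).contDiffWithinAt

/-- A complex elliptic curve `ℂ / Λ`, given by a lattice `Λ` of rank two in `ℂ`. -/
structure EllipticCurve where
  lattice : AddSubgroup ℂ
  discrete : DiscreteTopology lattice
  span_eq_top : Submodule.span ℝ (lattice : Set ℂ) = ⊤

instance (E : EllipticCurve) : DiscreteTopology E.lattice := E.discrete

/-- The points of an elliptic curve, as a complex Lie group. -/
abbrev EllipticCurve.Points (E : EllipticCurve) : Type := ℂ ⧸ E.lattice

/-- `E₁` and `E₂` are isogenous: there is a surjective holomorphic homomorphism `E₁ → E₂` with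
finite kernel. -/
def Isogenous (E₁ E₂ : EllipticCurve) : Prop :=
  ∃ f : E₁.Points →+ E₂.Points, MDifferentiable 𝓘(ℂ, ℂ) 𝓘(ℂ, ℂ) f ∧
    Function.Surjective f ∧ (f.ker : Set E₁.Points).Finite

/-- The complex vector space `ℂ²`. -/
abbrev C2 : Type := Fin 2 → ℂ

/-- `f` is a surjective homomorphism of complex Lie groups from `ℂ² / Γ` to `E`. -/
def IsHolomorphicSurjection (Γ : AddSubgroup C2) [DiscreteTopology Γ] (E : EllipticCurve)
    (f : C2 ⧸ Γ →+ E.Points) : Prop :=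
  MDifferentiable 𝓘(ℂ, C2) 𝓘(ℂ, ℂ) f ∧ Function.Surjective f

/-- `ℂ² / Γ` is isomorphic to `ℂ* × E` as a complex Lie group, for some elliptic curve `E`. -/
def Splits (Γ : AddSubgroup C2) [DiscreteTopology Γ] : Prop :=
  ∃ (E : EllipticCurve) (φ : C2 ⧸ Γ ≃ ℂˣ × E.Points),
    (∀ x y, φ (x + y) = ((φ x).1 * (φ y).1, (φ x).2 + (φ y).2)) ∧
    MDifferentiable 𝓘(ℂ, C2) (𝓘(ℂ, ℂ).prod 𝓘(ℂ, ℂ)) φ ∧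
    MDifferentiable (𝓘(ℂ, ℂ).prod 𝓘(ℂ, ℂ)) 𝓘(ℂ, C2) φ.symm

/-- After a linear change of coordinates on `ℂ²`, the group `Γ` lies in `k²` for some cubic number
field `k` inside `ℂ`. -/
def IsCubic (Γ : AddSubgroup C2) : Prop :=
  ∃ k : IntermediateField ℚ ℂ, Module.finrank ℚ k = 3 ∧
    ∃ A : C2 ≃ₗ[ℂ] C2, ∀ γ ∈ Γ, ∀ i, A γ i ∈ k

end SemiTorus

end

/-! Everything is read off from linear data. A holomorphic homomorphism of quotients lifts to a
linear map (`exists_linear_lift`), and two elliptic curves are isogenous as soon as some nonzero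
multiple of one lattice lies in the rational span of the other (`isogenous_of_mul_mem_ratSpan`).

If `Γ` meets a complex line in rank 2, that line splits off and gives (i): `HasEllipticLine.splits`.

(a) Choose coordinates with `Γ` generated by (1,0), (0,1), (a,b), where b is not real. Projecting
along (a+x, b+y) gives an elliptic quotient with periods b+y, a+x for almost all integers x. Being
isogenous to the quotient with periods 1, b, it makes (a+x)/(b+y) a fractional linear expression in
b with integer coefficients. Comparing two such relations (`linear_or_cubic_of_moebius`), either a,
b, 1 satisfy a rational linear relation, which yields an elliptic line, or b is cubic and a lies in
ℚ(b).

(b) If `T` splits, a quotient map with finitely many kernel components cannot kill the elliptic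
factor, by a rank count, so it is nonzero there (`isogenous_of_line`). If `T` is cubic and does not
split, the kernel of each map contains a nonzero vector of `Γ`, so up to a scalar the periods span a
rational plane in k. Any two planes in a cubic field differ by a factor
(`exists_mul_mem_of_finrank_eq_three`). -/

noncomputable section

namespace SemiTorus

open Filter Topology Module

/-! ### Holomorphic maps and homomorphisms of quotients by discrete groups -/

section Manifold

variable {V W : Type*} [NormedAddCommGroup V] [NormedSpace ℂ V]
  [NormedAddCommGroup W] [NormedSpace ℂ W]

theorem mk_eq_and_symm_mem_maximalAtlas (Γ : AddSubgroup V) [DiscreteTopology Γ] (v : V) :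
    ∃ e : OpenPartialHomeomorph V (V ⧸ Γ), (QuotientAddGroup.mk : V → V ⧸ Γ) = e ∧
      v ∈ e.source ∧ e.symm ∈ IsManifold.maximalAtlas 𝓘(ℂ, V) ω (V ⧸ Γ) := by
  obtain ⟨e, hv, he⟩ := isLocalHomeomorph_mk Γ v
  exact ⟨e, he, hv, IsManifold.subset_maximalAtlas ⟨e, he, rfl⟩⟩

theorem mdifferentiable_mk (Γ : AddSubgroup V) [DiscreteTopology Γ] :
    MDifferentiable 𝓘(ℂ, V) 𝓘(ℂ, V) (QuotientAddGroup.mk : V → V ⧸ Γ) := by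
  intro v
  obtain ⟨e, he, hv, hmem⟩ := mk_eq_and_symm_mem_maximalAtlas Γ v
  have h := contMDiffOn_symm_of_mem_maximalAtlas hmem
  simp only [OpenPartialHomeomorph.symm_symm, OpenPartialHomeomorph.symm_target] at h
  rw [he]
  exact ((h v hv).contMDiffAt (e.open_source.mem_nhds hv)).mdifferentiableAt (by simp)

/-- Holomorphic local sections of the projection `V → V / Γ`. -/
theorem exists_localSection (Γ : AddSubgroup V) [DiscreteTopology Γ] (v : V) :
    ∃ σ : V ⧸ Γ → V, σ (v : V ⧸ Γ) = v ∧
      (∀ᶠ q in 𝓝 (v : V ⧸ Γ), (σ q : V ⧸ Γ) = q) ∧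
      ∀ᶠ q in 𝓝 (v : V ⧸ Γ), MDifferentiableAt 𝓘(ℂ, V) 𝓘(ℂ, V) σ q := by
  obtain ⟨e, he, hv, hmem⟩ := mk_eq_and_symm_mem_maximalAtlas Γ v
  have hopen : e.target ∈ 𝓝 (v : V ⧸ Γ) := by
    rw [he]; exact e.open_target.mem_nhds (e.map_source hv)
  have h := contMDiffOn_of_mem_maximalAtlas hmem
  refine ⟨e.symm, ?_, ?_, ?_⟩
  · rw [he]; exact e.left_inv hv
  · filter_upwards [hopen] with q hq
    rw [he]; exact e.right_inv hq
  · filter_upwards [hopen] with q hq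
    exact ((h q hq).contMDiffAt (e.open_target.mem_nhds hq)).mdifferentiableAt (by simp)

/-- A map out of `V / Γ` is holomorphic if its pullback to `V` is. -/
theorem mdifferentiable_of_comp_mk {H E N : Type*} [NormedAddCommGroup E] [NormedSpace ℂ E]
    [TopologicalSpace H] [TopologicalSpace N] [ChartedSpace H N] {I : ModelWithCorners ℂ E H}
    (Γ : AddSubgroup V) [DiscreteTopology Γ] {f : V ⧸ Γ → N}
    (hf : MDifferentiable 𝓘(ℂ, V) I (fun v : V => f v)) : MDifferentiable 𝓘(ℂ, V) I f := by
  intro q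
  obtain ⟨v, rfl⟩ := QuotientAddGroup.mk_surjective q
  obtain ⟨σ, -, h2, h3⟩ := exists_localSection Γ v
  have := (hf (σ v)).comp (v : V ⧸ Γ) h3.self_of_nhds
  refine this.congr_of_eventuallyEq ?_
  filter_upwards [h2] with q hq
  simp [Function.comp, hq]

/-- A continuous linear map carrying `Γ` into `Λ` induces a holomorphic homomorphism. -/
theorem exists_hom_of_linear (Γ : AddSubgroup V) [DiscreteTopology Γ]
    (Λ : AddSubgroup W) [DiscreteTopology Λ] (D : V →L[ℂ] W) (hD : ∀ γ ∈ Γ, D γ ∈ Λ) :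
    ∃ f : V ⧸ Γ →+ W ⧸ Λ, MDifferentiable 𝓘(ℂ, V) 𝓘(ℂ, W) f ∧ ∀ v : V, f v = (D v : W ⧸ Λ) := by
  refine ⟨QuotientAddGroup.map Γ Λ (D : V →+ W) hD, ?_, fun v => rfl⟩
  apply mdifferentiable_of_comp_mk
  exact (mdifferentiable_mk Λ).comp D.differentiable.mdifferentiable

/-- Every holomorphic homomorphism `V / Γ → W / Λ` is induced by a linear map. -/
theorem exists_linear_lift (Γ : AddSubgroup V) [DiscreteTopology Γ]
    (Λ : AddSubgroup W) [hΛ : DiscreteTopology Λ] (f : V ⧸ Γ →+ W ⧸ Λ)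
    (hf : MDifferentiable 𝓘(ℂ, V) 𝓘(ℂ, W) f) :
    ∃ D : V →L[ℂ] W, ∀ v : V, f v = (D v : W ⧸ Λ) := by
  set F : V → W ⧸ Λ := fun v => f v with hF
  have hFd : MDifferentiable 𝓘(ℂ, V) 𝓘(ℂ, W) F := hf.comp (mdifferentiable_mk Γ)
  have hFsub (u v : V) : F (u - v) = F u - F v := by simp [hF]
  have hF0 : F 0 = ((0 : W) : W ⧸ Λ) := by simp [hF]
  obtain ⟨σ, hσ0, hσ, hσd⟩ := exists_localSection Λ (0 : W)
  have hlim : Tendsto F (𝓝 0) (𝓝 ((0 : W) : W ⧸ Λ)) := by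
    have := (hFd 0).continuousAt
    rwa [ContinuousAt, hF0] at this
  set h : V → W := fun v => σ (F v) with hh
  have hh0 : h 0 = 0 := by simp only [hh, hF0, hσ0]
  obtain ⟨r, hr, hball⟩ := Metric.eventually_nhds_iff_ball.1
    ((hlim.eventually hσ).and (hlim.eventually hσd))
  have hmk : ∀ u ∈ Metric.ball (0 : V) r, (h u : W ⧸ Λ) = F u := fun u hu => (hball u hu).1
  have hdiff : ∀ u ∈ Metric.ball (0 : V) r, DifferentiableAt ℂ h u := fun u hu =>
    mdifferentiableAt_iff_differentiableAt.1 ((hball u hu).2.comp u (hFd u))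
  set D := fderiv ℂ h 0 with hDdef
  have hd0 : HasFDerivAt h D 0 := (hdiff 0 (Metric.mem_ball_self hr)).hasFDerivAt
  -- The local lift `h` is additive modulo `Λ`; by continuity and discreteness the error vanishes
  -- near `u`, so the derivative at `u` equals that at 0.
  have hderiv : ∀ u ∈ Metric.ball (0 : V) r, HasFDerivAt h D u := by
    intro u hu
    have hcont : ContinuousAt (fun v => h v - h u - h (v - u)) u := by
      refine ((hdiff u hu).continuousAt.sub continuousAt_const).sub ?_
      refine ContinuousAt.comp (g := h) ?_ (continuousAt_id.sub continuousAt_const)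
      simpa using hd0.continuousAt
    obtain ⟨U, hU, hU'⟩ := nhds_inter_eq_singleton_of_mem_discrete (s := (Λ : Set W))
      ⟨hΛ⟩ Λ.zero_mem
    have h1 : ∀ᶠ v in 𝓝 u, h v - h u - h (v - u) ∈ U := by
      apply hcont.preimage_mem_nhds
      simpa [hh0] using hU
    have h2 : ∀ᶠ v in 𝓝 u, v - u ∈ Metric.ball (0 : V) r := by
      have : ContinuousAt (fun v : V => v - u) u := by fun_prop
      apply this.preimage_mem_nhds
      simpa using Metric.ball_mem_nhds (0 : V) hr
    have h3 : h =ᶠ[𝓝 u] fun v => h u + h (v - u) := by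
      filter_upwards [h1, h2, Metric.isOpen_ball.mem_nhds hu] with v hv1 hv2 hv3
      have hmem : h v - h u - h (v - u) ∈ Λ := by
        rw [← QuotientAddGroup.eq_zero_iff]
        rw [QuotientAddGroup.mk_sub, QuotientAddGroup.mk_sub, hmk v hv3, hmk u hu, hmk _ hv2, hFsub]
        abel
      have : h v - h u - h (v - u) ∈ U ∩ (Λ : Set W) := ⟨hv1, hmem⟩
      rw [hU'] at this
      have h0 : h v - h u - h (v - u) = 0 := this
      rw [sub_sub, sub_eq_zero] at h0
      exact h0
    have h4 : HasFDerivAt (fun v => h u + h (v - u)) D u := by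
      have h5 : HasFDerivAt (fun v : V => v - u) (ContinuousLinearMap.id ℂ V) u :=
        (hasFDerivAt_id u).sub_const u
      have h6 : HasFDerivAt h D (u - u) := by simpa using hd0
      simpa using (HasFDerivAt.comp (g := h) (f := fun v => v - u) u h6 h5).const_add (h u)
    exact h4.congr_of_eventuallyEq h3
  have hlin : ∀ u ∈ Metric.ball (0 : V) r, h u = D u := by
    intro u hu
    have hg : ∀ v ∈ Metric.ball (0 : V) r, HasFDerivAt (fun v => h v - D v) (0 : V →L[ℂ] W) v :=
      fun v hv => by
        have := (hderiv v hv).sub D.hasFDerivAt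
        rwa [sub_self] at this
    have := Metric.isOpen_ball.is_const_of_fderiv_eq_zero
      (convex_ball (0 : V) r).isPreconnected
      (fun v hv => (hg v hv).differentiableAt.differentiableWithinAt)
      (fun v hv => (hg v hv).fderiv) hu (Metric.mem_ball_self hr)
    simpa [hh0, sub_eq_zero] using this
  refine ⟨D, fun v => ?_⟩
  -- An arbitrary vector is n times a vector of the ball, and both sides are additive.
  obtain ⟨n, hn⟩ := exists_nat_gt (‖v‖ / r)
  have hn0 : (0 : ℝ) < n := lt_of_le_of_lt (by positivity) hn
  have hnC : (n : ℂ) ≠ 0 := by exact_mod_cast hn0.ne'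
  set u : V := (n : ℂ)⁻¹ • v with hu
  have huv : n • u = v := by
    rw [hu, ← Nat.cast_smul_eq_nsmul ℂ, smul_smul, mul_inv_cancel₀ hnC, one_smul]
  have hub : u ∈ Metric.ball (0 : V) r := by
    rw [mem_ball_zero_iff, hu, norm_smul, norm_inv, Complex.norm_natCast, inv_mul_lt_iff₀ hn0]
    rwa [div_lt_iff₀ hr] at hn
  have h7 : F u = (D u : W ⧸ Λ) := by rw [← hmk u hub, hlin u hub]
  have h8 : F (n • u) = n • F u := by simp [hF]
  rw [huv] at h8
  change F v = _
  rw [h8, h7, ← huv, map_nsmul]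
  rfl

/-- A bijection out of `V / Γ` has a holomorphic inverse if its pullback to `V` has holomorphic
local sections. -/
theorem mdifferentiable_symm_of_localSection {H E N : Type*} [NormedAddCommGroup E]
    [NormedSpace ℂ E] [TopologicalSpace H] [TopologicalSpace N] [ChartedSpace H N]
    {I : ModelWithCorners ℂ E H} (Γ : AddSubgroup V) [DiscreteTopology Γ] (φ : V ⧸ Γ ≃ N)
    (h : ∀ y : N, ∃ σ : N → V, MDifferentiableAt I 𝓘(ℂ, V) σ y ∧
      ∀ᶠ z in 𝓝 y, φ (σ z : V ⧸ Γ) = z) : MDifferentiable I 𝓘(ℂ, V) φ.symm := by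
  intro y
  obtain ⟨σ, h1, h2⟩ := h y
  refine ((mdifferentiable_mk Γ (σ y)).comp y h1).congr_of_eventuallyEq ?_
  filter_upwards [h2] with z hz
  exact (φ.symm_apply_eq).2 hz.symm

theorem mdifferentiable_units_of_val {f : V → ℂˣ}
    (hf : Differentiable ℂ fun v => (f v : ℂ)) : MDifferentiable 𝓘(ℂ, V) 𝓘(ℂ, ℂ) f := by
  intro v
  rw [mdifferentiableAt_iff]
  refine ⟨?_, ?_⟩
  · exact (Units.isOpenEmbedding_val.isInducing.continuousAt_iff).2 (hf v).continuousAt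
  · simp only [writtenInExtChartAt, extChartAt, mfld_simps]
    exact (hf v).differentiableWithinAt

end Manifold

/-! ### Ranks and rational spans of discrete subgroups -/

section Lattice

variable {V : Type*} [NormedAddCommGroup V] [NormedSpace ℝ V] [FiniteDimensional ℝ V]

instance instDiscreteToIntSubmodule (S : AddSubgroup V) [h : DiscreteTopology S] :
    DiscreteTopology (AddSubgroup.toIntSubmodule S) := h

instance instFiniteOfDiscrete (S : AddSubgroup V) [DiscreteTopology S] : Module.Finite ℤ S :=
  inferInstanceAs (Module.Finite ℤ (AddSubgroup.toIntSubmodule S))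

theorem discreteTopology_of_le {X : Type*} [AddGroup X] [TopologicalSpace X]
    {S T : AddSubgroup X} (hT : DiscreteTopology T) (h : S ≤ T) :
    DiscreteTopology S :=
  DiscreteTopology.of_subset (s := (T : Set X)) hT h

/-- A discrete subgroup has a `ℤ`-basis consisting of vectors that are independent over `ℝ`. -/
theorem exists_real_basis (S : AddSubgroup V) [DiscreteTopology S] :
    ∃ b : Fin (finrank ℤ S) → V, LinearIndependent ℝ b ∧
      Submodule.span ℤ (Set.range b) = AddSubgroup.toIntSubmodule S := by
  set L := AddSubgroup.toIntSubmodule S with hL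
  let b : Basis (Fin (finrank ℤ S)) ℤ L := finBasis ℤ L
  have hspan : Submodule.span ℤ (Set.range fun i => (b i : V)) = L := by
    have := congrArg (Submodule.map L.subtype) b.span_eq
    rw [Submodule.map_span, ← Set.range_comp, Submodule.map_top, Submodule.range_subtype] at this
    exact this
  refine ⟨fun i => b i, ?_, hspan⟩
  have hdisc : DiscreteTopology (Submodule.span ℤ (Set.range fun i => (b i : V))) := by
    rw [hspan]; infer_instance
  -- For a discrete group the ℤ-rank equals the real dimension of the span, so a ℤ-basis has no real
  -- relation.
  rw [linearIndependent_iff_card_eq_finrank_span, Real.finrank_eq_int_finrank_of_discrete hdisc,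
    Set.finrank, hspan, Fintype.card_fin]
  rfl

theorem card_le_finrank_int {ι : Type*} [Fintype ι] (S : AddSubgroup V) [DiscreteTopology S]
    {v : ι → V} (hv : LinearIndependent ℝ v) (hS : ∀ i, v i ∈ S) :
    Fintype.card ι ≤ finrank ℤ S := by
  have h1 : LinearIndependent ℤ v := hv.restrict_scalars (by
    intro a b h
    simpa using h)
  have h2 : LinearIndependent ℤ (fun i => (⟨v i, hS i⟩ : S)) :=
    LinearIndependent.of_comp S.subtype.toIntLinearMap h1
  exact h2.fintype_card_le_finrank

theorem finrank_int_le_of_mem_submodule (S : AddSubgroup V) [DiscreteTopology S]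
    (P : Submodule ℝ V) (h : ∀ x ∈ S, x ∈ P) : finrank ℤ S ≤ finrank ℝ P := by
  obtain ⟨b, hb, hspan⟩ := exists_real_basis S
  have hbS : ∀ i, b i ∈ S := fun i => by
    have : b i ∈ AddSubgroup.toIntSubmodule S := hspan ▸ Submodule.subset_span ⟨i, rfl⟩
    exact this
  have h2 : LinearIndependent ℝ (fun i => (⟨b i, h _ (hbS i)⟩ : P)) :=
    LinearIndependent.of_comp P.subtype hb
  simpa using h2.fintype_card_le_finrank

theorem finrank_map_add_finrank_inf_ker {W : Type*} [AddCommGroup W] (S : AddSubgroup V)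
    [DiscreteTopology S] (L : V →+ W) :
    finrank ℤ (S.map L) + finrank ℤ (S ⊓ L.ker : AddSubgroup V) = finrank ℤ S := by
  let f : S →ₗ[ℤ] W := (L.comp S.subtype).toIntLinearMap
  have h := Submodule.finrank_quotient_add_finrank (LinearMap.ker f)
  rw [f.quotKerEquivRange.finrank_eq] at h
  rw [← h]
  congr 1
  · have : AddSubgroup.toIntSubmodule (S.map L) = LinearMap.range f := by
      ext x
      exact ⟨fun ⟨y, hy, h⟩ => ⟨⟨y, hy⟩, h⟩, fun ⟨y, h⟩ => ⟨y, y.2, h⟩⟩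
    exact congrArg (fun M : Submodule ℤ W => finrank ℤ M) this
  · let g : LinearMap.ker f →+ (S ⊓ L.ker : AddSubgroup V) :=
      { toFun := fun x => ⟨x.1.1, x.1.2, x.2⟩
        map_zero' := rfl
        map_add' := fun _ _ => rfl }
    have hg : Function.Bijective g := by
      refine ⟨fun x y hxy => ?_, fun y => ⟨⟨⟨y.1, y.2.1⟩, y.2.2⟩, rfl⟩⟩
      ext
      exact congrArg (fun z : (S ⊓ L.ker : AddSubgroup V) => (z : V)) hxy
    exact (LinearEquiv.ofBijective g.toIntLinearMap hg).finrank_eq.symm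

theorem finrank_span_rat (S : AddSubgroup ℂ) [DiscreteTopology S] :
    finrank ℚ (Submodule.span ℚ (S : Set ℂ)) = finrank ℤ S := by
  obtain ⟨b, hb, hspan⟩ := exists_real_basis S
  have h : Submodule.span ℚ (S : Set ℂ) = Submodule.span ℚ (Set.range b) := by
    have : (S : Set ℂ) = Submodule.span ℤ (Set.range b) := by rw [hspan]; rfl
    rw [this, Submodule.span_span_of_tower]
  have hQ : LinearIndependent ℚ b := hb.restrict_scalars (by
    intro a b h
    simpa using h)
  rw [h, finrank_span_eq_card hQ, Fintype.card_fin]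

theorem finite_span_rat (S : AddSubgroup ℂ) [DiscreteTopology S] :
    FiniteDimensional ℚ (Submodule.span ℚ (S : Set ℂ)) := by
  obtain ⟨b, hb, hspan⟩ := exists_real_basis S
  have h : Submodule.span ℚ (S : Set ℂ) = Submodule.span ℚ (Set.range b) := by
    have : (S : Set ℂ) = Submodule.span ℤ (Set.range b) := by rw [hspan]; rfl
    rw [this, Submodule.span_span_of_tower]
  rw [h]
  exact FiniteDimensional.span_of_finite ℚ (Set.finite_range b)

theorem exists_nat_smul_mem_of_mem_span_rat {W : Type*} [AddCommGroup W] [Module ℚ W]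
    (S : AddSubgroup W) {x : W} (hx : x ∈ Submodule.span ℚ (S : Set W)) :
    ∃ n : ℕ, n ≠ 0 ∧ n • x ∈ S := by
  induction hx using Submodule.span_induction with
  | mem x hx => exact ⟨1, one_ne_zero, by simpa using hx⟩
  | zero => exact ⟨1, one_ne_zero, by simp⟩
  | add x y _ _ hx hy =>
    obtain ⟨n, hn, hnx⟩ := hx
    obtain ⟨m, hm, hmy⟩ := hy
    refine ⟨n * m, mul_ne_zero hn hm, ?_⟩
    rw [smul_add]
    refine S.add_mem ?_ ?_
    · rw [mul_comm, mul_smul]; exact S.nsmul_mem hnx m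
    · rw [mul_smul]; exact S.nsmul_mem hmy n
  | smul q x _ hx =>
    obtain ⟨n, hn, hnx⟩ := hx
    refine ⟨n * q.den, mul_ne_zero hn q.den_ne_zero, ?_⟩
    have : (n * q.den) • q • x = q.num • n • x := by
      rw [← Nat.cast_smul_eq_nsmul ℚ, ← Int.cast_smul_eq_zsmul ℚ, ← Nat.cast_smul_eq_nsmul ℚ,
        smul_smul, smul_smul]
      congr 1
      push_cast
      rw [mul_assoc, Rat.den_mul_eq_num, mul_comm]
    rw [this]
    exact S.zsmul_mem hnx _

theorem finite_map {W W' : Type*} [AddCommGroup W] [AddCommGroup W'] (S : AddSubgroup W)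
    [Module.Finite ℤ S] (L : W →+ W') : Module.Finite ℤ (S.map L) :=
  Module.Finite.of_surjective (L.addSubgroupMap S).toIntLinearMap (L.addSubgroupMap_surjective S)

theorem exists_nat_forall_smul_mem {W : Type*} [AddCommGroup W] [Module ℚ W]
    (S T : AddSubgroup W) [Module.Finite ℤ S] (h : ∀ x ∈ S, x ∈ Submodule.span ℚ (T : Set W)) :
    ∃ n : ℕ, n ≠ 0 ∧ ∀ x ∈ S, n • x ∈ T := by
  obtain ⟨s, hs⟩ := (Module.Finite.fg_top : (⊤ : Submodule ℤ S).FG)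
  choose N hN0 hN using fun x : S => exists_nat_smul_mem_of_mem_span_rat T (h x x.2)
  refine ⟨∏ x ∈ s, N x, Finset.prod_ne_zero_iff.2 fun x _ => hN0 x, fun x hx => ?_⟩
  have key : ∀ y : S, y ∈ Submodule.span ℤ (s : Set S) → (∏ x ∈ s, N x) • (y : W) ∈ T := by
    intro y hy
    induction hy using Submodule.span_induction with
    | mem y hy =>
      obtain ⟨m, hm⟩ := Finset.dvd_prod_of_mem N hy
      rw [hm, mul_comm, mul_smul]
      exact T.nsmul_mem (hN y) m
    | zero => simp
    | add a b _ _ ha hb => push_cast; rw [smul_add]; exact T.add_mem ha hb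
    | smul n a _ ha =>
      have : ((n • a : S) : W) = n • (a : W) := rfl
      rw [this, smul_comm]; exact T.zsmul_mem ha n
  exact key ⟨x, hx⟩ (hs ▸ Submodule.mem_top)

end Lattice

/-! ### Elliptic curves and isogenies in terms of periods -/

namespace EllipticCurve

theorem exists_basis (E : EllipticCurve) : ∃ b : Fin 2 → ℂ, LinearIndependent ℝ b ∧
    Submodule.span ℤ (Set.range b) = AddSubgroup.toIntSubmodule E.lattice := by
  obtain ⟨b, hb, hspan⟩ := exists_real_basis E.lattice
  have h : Submodule.span ℝ (Set.range b) = ⊤ := by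
    have : (E.lattice : Set ℂ) = Submodule.span ℤ (Set.range b) := by rw [hspan]; rfl
    rw [← E.span_eq_top, this, Submodule.span_span_of_tower]
  have h2 : finrank ℤ E.lattice = 2 := by
    have := finrank_span_eq_card hb
    rw [h, finrank_top, Complex.finrank_real_complex, Fintype.card_fin] at this
    exact this.symm
  rw [← h2]
  exact ⟨b, hb, hspan⟩

theorem finrank_lattice (E : EllipticCurve) : finrank ℤ E.lattice = 2 := by
  obtain ⟨b, hb, hspan⟩ := E.exists_basis
  refine le_antisymm ?_ ?_
  · have := finrank_int_le_of_mem_submodule E.lattice ⊤ fun _ _ => Submodule.mem_top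
    rwa [finrank_top, Complex.finrank_real_complex] at this
  · have hbS : ∀ i, b i ∈ E.lattice := fun i => by
      have : b i ∈ AddSubgroup.toIntSubmodule E.lattice := hspan ▸ Submodule.subset_span ⟨i, rfl⟩
      exact this
    simpa using card_le_finrank_int E.lattice hb hbS

/-- The rational vector space spanned by the periods. -/
def ratSpan (E : EllipticCurve) : Submodule ℚ ℂ := Submodule.span ℚ (E.lattice : Set ℂ)

theorem mem_ratSpan (E : EllipticCurve) {x : ℂ} (hx : x ∈ E.lattice) : x ∈ E.ratSpan :=
  Submodule.subset_span hx

theorem finrank_ratSpan (E : EllipticCurve) : finrank ℚ E.ratSpan = 2 :=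
  (finrank_span_rat _).trans E.finrank_lattice

instance (E : EllipticCurve) : FiniteDimensional ℚ E.ratSpan := finite_span_rat _

theorem exists_notMem_lattice (E : EllipticCurve) : ∃ z : ℂ, z ∉ E.lattice := by
  by_contra! h
  obtain ⟨U, hU, hU'⟩ := nhds_inter_eq_singleton_of_mem_discrete (s := (E.lattice : Set ℂ))
    ⟨E.discrete⟩ E.lattice.zero_mem
  apply infinite_of_mem_nhds (0 : ℂ) hU
  rw [← Set.inter_eq_left.2 (fun z _ => h z : U ⊆ E.lattice), hU']
  exact Set.finite_singleton 0

theorem Points.exists_ne_zero (E : EllipticCurve) : ∃ x : E.Points, x ≠ 0 := by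
  obtain ⟨z, hz⟩ := E.exists_notMem_lattice
  exact ⟨z, by rwa [Ne, QuotientAddGroup.eq_zero_iff]⟩

/-- The elliptic curve with periods `a` and `b`. -/
def ofPair {a b : ℂ} (h : LinearIndependent ℝ ![a, b]) : EllipticCurve where
  lattice := (Submodule.span ℤ (Set.range ![a, b])).toAddSubgroup
  discrete := by
    have hb : Set.range ![a, b] = Set.range (basisOfLinearIndependentOfCardEqFinrank h
        (by simp)) := by simp
    rw [hb]
    infer_instance
  span_eq_top := by
    have : ((Submodule.span ℤ (Set.range ![a, b])).toAddSubgroup : Set ℂ) =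
      Submodule.span ℤ (Set.range ![a, b]) := rfl
    rw [this, Submodule.span_span_of_tower]
    exact h.span_eq_top_of_card_eq_finrank (by simp)

theorem mem_ofPair_lattice {a b : ℂ} (h : LinearIndependent ℝ ![a, b]) {x : ℂ} :
    x ∈ (ofPair h).lattice ↔ ∃ m n : ℤ, m * a + n * b = x := by
  change x ∈ Submodule.span ℤ (Set.range ![a, b]) ↔ _
  simp only [Matrix.range_cons, Matrix.range_empty, Set.union_empty, Set.singleton_union,
    Submodule.mem_span_pair, zsmul_eq_mul]

end EllipticCurve

theorem linearIndependent_pair_iff {a b : ℂ} (ha : a ≠ 0) :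
    LinearIndependent ℝ ![a, b] ↔ (b / a).im ≠ 0 := by
  rw [LinearIndependent.pair_iff' ha]
  constructor
  · intro h h0
    apply h (b / a).re
    have : (((b / a).re : ℝ) : ℂ) = b / a := by
      apply Complex.ext <;> simp [h0]
    rw [Complex.real_smul, this, div_mul_cancel₀ _ ha]
  · rintro h t rfl
    apply h
    rw [Complex.real_smul, mul_div_cancel_right₀ _ ha, Complex.ofReal_im]

/-- The factor is the linear lift of the isogeny; it is nonzero because the target is not trivial.
-/
theorem Isogenous.exists_mul {E₁ E₂ : EllipticCurve} (h : Isogenous E₁ E₂) :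
    ∃ c : ℂ, c ≠ 0 ∧ ∀ x ∈ E₁.lattice, c * x ∈ E₂.lattice := by
  obtain ⟨f, hf, hsurj, -⟩ := h
  obtain ⟨D, hD⟩ := exists_linear_lift E₁.lattice E₂.lattice f hf
  have hD1 (z : ℂ) : D z = D 1 * z := by
    have := D.map_smul z 1
    rw [smul_eq_mul, mul_one, smul_eq_mul] at this
    rw [this, mul_comm]
  refine ⟨D 1, fun h0 => ?_, fun x hx => ?_⟩
  · obtain ⟨y, hy⟩ := EllipticCurve.Points.exists_ne_zero E₂
    obtain ⟨x, rfl⟩ := hsurj y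
    obtain ⟨z, rfl⟩ := QuotientAddGroup.mk_surjective x
    apply hy
    rw [hD, hD1, h0, zero_mul, QuotientAddGroup.mk_zero]
  · rw [← hD1, ← QuotientAddGroup.eq_zero_iff, ← hD, (QuotientAddGroup.eq_zero_iff x).2 hx, map_zero]

/-- Both rational spans have dimension 2, so the inclusion of one, scaled by `c`, into the other is
an equality. -/
theorem inv_mul_mem_ratSpan {E₁ E₂ : EllipticCurve} {c : ℂ} (hc : c ≠ 0)
    (h : ∀ x ∈ E₁.lattice, c * x ∈ E₂.ratSpan) : ∀ y ∈ E₂.lattice, c⁻¹ * y ∈ E₁.ratSpan := by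
  let μ : ℂ →ₗ[ℚ] ℂ := LinearMap.mulLeft ℚ c
  have hμ : Function.Injective μ := mul_right_injective₀ hc
  have hle : E₁.ratSpan.map μ ≤ E₂.ratSpan := by
    rw [EllipticCurve.ratSpan, Submodule.map_span, Submodule.span_le]
    rintro _ ⟨x, hx, rfl⟩
    exact h x hx
  have heq : E₁.ratSpan.map μ = E₂.ratSpan := by
    apply Submodule.eq_of_le_of_finrank_eq hle
    rw [E₂.finrank_ratSpan, ← E₁.finrank_ratSpan]
    exact ((Submodule.equivMapOfInjective μ hμ E₁.ratSpan).finrank_eq).symm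
  intro y hy
  obtain ⟨x, hx, hxy⟩ : y ∈ E₁.ratSpan.map μ := heq ▸ E₂.mem_ratSpan hy
  rw [← hxy, LinearMap.mulLeft_apply, inv_mul_cancel_left₀ hc]
  exact hx

/-- Clearing denominators by `n`, multiplication by `n * c` induces the isogeny. Its kernel is a
finitely generated quotient of the target lattice, killed by `n * m` where `m` clears the
denominators of the inverse; hence it is finite. -/
theorem isogenous_of_mul_mem_ratSpan {E₁ E₂ : EllipticCurve} {c : ℂ} (hc : c ≠ 0)
    (h : ∀ x ∈ E₁.lattice, c * x ∈ E₂.ratSpan) : Isogenous E₁ E₂ := by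
  have hinv := inv_mul_mem_ratSpan hc h
  have := finite_map E₁.lattice (AddMonoidHom.mulLeft c)
  obtain ⟨n, hn, hnmem⟩ := exists_nat_forall_smul_mem
    (E₁.lattice.map (AddMonoidHom.mulLeft c)) E₂.lattice (by
      rintro _ ⟨x, hx, rfl⟩
      exact h x hx)
  have := finite_map E₂.lattice (AddMonoidHom.mulLeft c⁻¹)
  obtain ⟨m, hm, hmmem⟩ := exists_nat_forall_smul_mem
    (E₂.lattice.map (AddMonoidHom.mulLeft c⁻¹)) E₁.lattice (by
      rintro _ ⟨x, hx, rfl⟩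
      exact hinv x hx)
  have hnC : (n : ℂ) ≠ 0 := Nat.cast_ne_zero.2 hn
  set d : ℂ := n * c with hd
  have hd0 : d ≠ 0 := mul_ne_zero hnC hc
  obtain ⟨f, hf, hfD⟩ := exists_hom_of_linear E₁.lattice E₂.lattice
    (ContinuousLinearMap.mul ℂ ℂ d) (fun x hx => by
      have := hnmem _ ⟨x, hx, rfl⟩
      simpa [hd, mul_assoc] using this)
  simp only [ContinuousLinearMap.mul_apply'] at hfD
  refine ⟨f, hf, fun y => ?_, ?_⟩
  · obtain ⟨z, rfl⟩ := QuotientAddGroup.mk_surjective y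
    exact ⟨(d⁻¹ * z : ℂ), by rw [hfD, mul_inv_cancel_left₀ hd0]⟩
  · let g : E₂.lattice →+ f.ker :=
      { toFun := fun y => ⟨((d⁻¹ * y : ℂ) : E₁.Points), by
          rw [AddMonoidHom.mem_ker, hfD, mul_inv_cancel_left₀ hd0, QuotientAddGroup.eq_zero_iff]
          exact y.2⟩
        map_zero' := by simp
        map_add' := fun x y => by simp [mul_add] }
    have hg : Function.Surjective g := by
      rintro ⟨x, hx⟩
      obtain ⟨z, rfl⟩ := QuotientAddGroup.mk_surjective x
      rw [AddMonoidHom.mem_ker, hfD, QuotientAddGroup.eq_zero_iff] at hx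
      exact ⟨⟨d * z, hx⟩, Subtype.ext (by simp [g, inv_mul_cancel_left₀ hd0])⟩
    have : Module.Finite ℤ f.ker := Module.Finite.of_surjective g.toIntLinearMap hg
    refine @Set.toFinite _ _ (Module.finite_of_fg_torsion f.ker ?_)
    intro x
    obtain ⟨y, rfl⟩ := hg x
    refine ⟨⟨(n * m : ℕ), mem_nonZeroDivisors_of_ne_zero (by positivity)⟩, ?_⟩
    have hy : ((n * m : ℕ) : ℂ) * (d⁻¹ * y) ∈ E₁.lattice := by
      have := hmmem _ ⟨y, y.2, rfl⟩
      have h2 : ((n * m : ℕ) : ℂ) * (d⁻¹ * y) = m • (c⁻¹ * y) := by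
        rw [hd, nsmul_eq_mul]
        push_cast
        field_simp
      rw [h2]
      exact this
    rw [Submonoid.mk_smul, natCast_zsmul]
    apply Subtype.ext
    have h3 := (QuotientAddGroup.eq_zero_iff (N := E₁.lattice) _).2 hy
    rw [← nsmul_eq_mul, QuotientAddGroup.mk_nsmul] at h3
    exact h3

/-! ### Complex lines in ℂ² and the rank of `Γ` on them -/

/-- `Γ` contains a lattice of rank two in some complex line. -/
def HasEllipticLine (Γ : AddSubgroup C2) : Prop :=
  ∃ (w : C2) (t : ℂ), w ≠ 0 ∧ t.im ≠ 0 ∧ w ∈ Γ ∧ t • w ∈ Γ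

theorem exists_apply_eq_one {w : C2} (hw : w ≠ 0) : ∃ N : C2 →ₗ[ℂ] ℂ, N w = 1 := by
  obtain ⟨i, hi⟩ : ∃ i, w i ≠ 0 := by
    by_contra! h
    exact hw (funext h)
  exact ⟨(w i)⁻¹ • LinearMap.proj i, by simp [hi]⟩

/-- The determinant `det (w, v)` as a functional of `v`. -/
def detLeft (w : C2) : C2 →ₗ[ℂ] ℂ := w 0 • LinearMap.proj 1 - w 1 • LinearMap.proj 0

@[simp]
theorem detLeft_apply (w v : C2) : detLeft w v = w 0 * v 1 - w 1 * v 0 := by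
  simp [detLeft]

theorem exists_eq_smul_of_detLeft_eq_zero {w v : C2} (hw : w ≠ 0) (h : detLeft w v = 0) :
    ∃ m : ℂ, v = m • w := by
  rw [detLeft_apply] at h
  by_cases h0 : w 0 = 0
  · have h1 : w 1 ≠ 0 := by
      intro h1
      apply hw
      ext i; fin_cases i <;> simp [h0, h1]
    refine ⟨v 1 / w 1, ?_⟩
    ext i; fin_cases i
    · have : v 0 = 0 := by simpa [h0, h1] using h
      simp [h0, this]
    · simp [h1]
  · refine ⟨v 0 / w 0, ?_⟩
    ext i; fin_cases i
    · simp [h0]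
    · simp only [Fin.mk_one, Pi.smul_apply, smul_eq_mul]
      field_simp
      linear_combination h

theorem exists_eq_mul_detLeft {g : C2} (hg : g ≠ 0) (L : C2 →ₗ[ℂ] ℂ) (hL : L g = 0) :
    ∃ c : ℂ, ∀ v, L v = c * detLeft g v := by
  have hexp (v : C2) : L v = v 0 * L (Pi.single 0 1) + v 1 * L (Pi.single 1 1) := by
    have h : v = v 0 • Pi.single 0 1 + v 1 • Pi.single 1 1 := by
      ext i; fin_cases i <;> simp
    conv_lhs => rw [h, map_add, map_smul, map_smul]
    rfl
  set l0 := L (Pi.single 0 1)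
  set l1 := L (Pi.single 1 1)
  have hg' := hexp g
  rw [hL] at hg'
  by_cases h0 : g 0 = 0
  · have h1 : g 1 ≠ 0 := by
      intro h1
      apply hg
      ext i; fin_cases i <;> simp [h0, h1]
    have hl1 : l1 = 0 := by simpa [h0, h1] using hg'
    refine ⟨-l0 / g 1, fun v => ?_⟩
    rw [hexp, detLeft_apply, hl1, h0]
    field_simp
    ring
  · refine ⟨l1 / g 0, fun v => ?_⟩
    rw [hexp, detLeft_apply]
    field_simp
    linear_combination (-v 0) * hg'

theorem linearIndependent_smul_pair {w : C2} {t : ℂ} (hw : w ≠ 0) (ht : t.im ≠ 0) :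
    LinearIndependent ℝ ![w, t • w] := by
  rw [LinearIndependent.pair_iff' hw]
  intro a h
  have h2 : ((a : ℂ) - t) • w = 0 := by
    rw [sub_smul, ← h]
    simp
  rcases smul_eq_zero.1 h2 with h3 | h3
  · apply ht
    rw [← sub_eq_zero.1 h3, Complex.ofReal_im]
  · exact hw h3

theorem finrank_inf_ker_le (Γ : AddSubgroup C2) [DiscreteTopology Γ] {L : C2 →ₗ[ℂ] ℂ}
    (hL : L ≠ 0) : finrank ℤ (Γ ⊓ (L : C2 →+ ℂ).ker : AddSubgroup C2) ≤ 2 := by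
  have : DiscreteTopology (Γ ⊓ (L : C2 →+ ℂ).ker : AddSubgroup C2) :=
    discreteTopology_of_le ‹_› inf_le_left
  refine (finrank_int_le_of_mem_submodule _ ((LinearMap.ker L).restrictScalars ℝ)
    fun x hx => (AddSubgroup.mem_inf.1 hx).2).trans ?_
  have h1 := L.finrank_range_add_finrank_ker
  have h2 : finrank ℂ (LinearMap.range L) = 1 := by
    rw [LinearMap.range_eq_top.2 (LinearMap.surjective hL), finrank_top, finrank_self]
  rw [h2, finrank_fin_fun] at h1
  have h3 := finrank_real_of_complex (LinearMap.ker L)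
  change finrank ℝ (LinearMap.ker L) ≤ 2
  omega

/-- Two ℝ-independent vectors of `Γ` in the complex line `ker L` have a ratio `t` that is not real.
-/
theorem hasEllipticLine_of_two_le (Γ : AddSubgroup C2) [DiscreteTopology Γ] {L : C2 →ₗ[ℂ] ℂ}
    (hL : L ≠ 0) (h : 2 ≤ finrank ℤ (Γ ⊓ (L : C2 →+ ℂ).ker : AddSubgroup C2)) :
    HasEllipticLine Γ := by
  have : DiscreteTopology (Γ ⊓ (L : C2 →+ ℂ).ker : AddSubgroup C2) :=
    discreteTopology_of_le ‹_› inf_le_left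
  obtain ⟨b, hb, hspan⟩ := exists_real_basis (Γ ⊓ (L : C2 →+ ℂ).ker)
  have hmem : ∀ i, b i ∈ Γ ⊓ (L : C2 →+ ℂ).ker := fun i => by
    have : b i ∈ AddSubgroup.toIntSubmodule (Γ ⊓ (L : C2 →+ ℂ).ker) :=
      hspan ▸ Submodule.subset_span ⟨i, rfl⟩
    exact this
  set i0 : Fin (finrank ℤ (Γ ⊓ (L : C2 →+ ℂ).ker : AddSubgroup C2)) := ⟨0, by omega⟩
  set i1 : Fin (finrank ℤ (Γ ⊓ (L : C2 →+ ℂ).ker : AddSubgroup C2)) := ⟨1, by omega⟩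
  have hw : b i0 ≠ 0 := hb.ne_zero i0
  have h01 : i0 ≠ i1 := by simp [i0, i1]
  obtain ⟨c, hc⟩ := exists_eq_mul_detLeft hw L (hmem i0).2
  have hc0 : c ≠ 0 := by
    rintro rfl
    exact hL (LinearMap.ext fun v => by simp [hc])
  have h1 : detLeft (b i0) (b i1) = 0 := by
    have : L (b i1) = 0 := (hmem i1).2
    rw [hc] at this
    exact (mul_eq_zero.1 this).resolve_left hc0
  obtain ⟨t, ht⟩ := exists_eq_smul_of_detLeft_eq_zero hw h1
  refine ⟨b i0, t, hw, fun him => ?_, (hmem i0).1, ht ▸ (hmem i1).1⟩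
  have hpair : LinearIndependent ℝ ![b i0, b i1] := by
    have := hb.comp ![i0, i1] (by
      intro x y hxy
      fin_cases x <;> fin_cases y <;> simp_all)
    have h2 : b ∘ ![i0, i1] = ![b i0, b i1] := by
      funext x; fin_cases x <;> rfl
    rwa [h2] at this
  rw [LinearIndependent.pair_iff' hw] at hpair
  apply hpair t.re
  rw [ht]
  have : ((t.re : ℝ) : ℂ) = t := by apply Complex.ext <;> simp [him]
  conv_rhs => rw [← this]
  simp

/-! ### Splitting off an elliptic curve -/

/-- The inclusion of the factor {1} × E lifts to a linear map ℂ → ℂ², and `w` is the image of 1. -/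
theorem Splits.exists_lattice {Γ : AddSubgroup C2} [DiscreteTopology Γ] (h : Splits Γ) :
    ∃ (E : EllipticCurve) (w : C2), w ≠ 0 ∧ ∀ z ∈ E.lattice, z • w ∈ Γ := by
  obtain ⟨E, φ, hadd, -, hsymm⟩ := h
  let ψ : E.Points →+ C2 ⧸ Γ := AddMonoidHom.mk' (fun e => φ.symm (1, e)) (by
    intro a b
    apply φ.injective
    rw [hadd]
    simp)
  have hψ : MDifferentiable 𝓘(ℂ, ℂ) 𝓘(ℂ, C2) ψ :=
    hsymm.comp (mdifferentiable_const.prodMk mdifferentiable_id)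
  obtain ⟨D, hD⟩ := exists_linear_lift E.lattice Γ ψ hψ
  have hD1 (z : ℂ) : D z = z • D 1 := by rw [← D.map_smul, smul_eq_mul, mul_one]
  refine ⟨E, D 1, fun h0 => ?_, fun z hz => ?_⟩
  · obtain ⟨e, he⟩ := EllipticCurve.Points.exists_ne_zero E
    apply he
    have h1 : ψ e = ψ 0 := by
      obtain ⟨z, rfl⟩ := QuotientAddGroup.mk_surjective e
      rw [hD, hD1, h0, smul_zero, map_zero, QuotientAddGroup.mk_zero]
    have := φ.symm.injective h1
    simpa using this
  · rw [← hD1, ← QuotientAddGroup.eq_zero_iff, ← hD, (QuotientAddGroup.eq_zero_iff z).2 hz, map_zero]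

/-- A discrete subgroup of rank three containing an elliptic line splits off that line. -/
theorem HasEllipticLine.exists_decomposition {Γ : AddSubgroup C2} [DiscreteTopology Γ]
    (hrank : finrank ℤ Γ = 3) (h : HasEllipticLine Γ) :
    ∃ (E : EllipticCurve) (γ w : C2) (u m : C2 →ₗ[ℂ] ℂ),
      u γ = 1 ∧ u w = 0 ∧ m γ = 0 ∧ m w = 1 ∧ (∀ v, v = u v • γ + m v • w) ∧
      ∀ v, v ∈ Γ ↔ (∃ n : ℤ, u v = n) ∧ m v ∈ E.lattice := by
  obtain ⟨w, t, hw, ht, hwΓ, htΓ⟩ := h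
  obtain ⟨N, hN⟩ := exists_apply_eq_one hw
  set L := detLeft w with hLdef
  have hLw : L w = 0 := by simp [hLdef, mul_comm]
  have hL0 : L ≠ 0 := by
    intro h0
    apply hw
    have h1 := LinearMap.congr_fun h0 (Pi.single 0 1)
    have h2 := LinearMap.congr_fun h0 (Pi.single 1 1)
    ext i
    fin_cases i
    · simpa [hLdef] using h2
    · simpa [hLdef] using h1
  have hK : DiscreteTopology (Γ ⊓ (L : C2 →+ ℂ).ker : AddSubgroup C2) :=
    discreteTopology_of_le ‹_› inf_le_left
  have hK2 : 2 ≤ finrank ℤ (Γ ⊓ (L : C2 →+ ℂ).ker : AddSubgroup C2) := by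
    have := card_le_finrank_int (Γ ⊓ (L : C2 →+ ℂ).ker) (linearIndependent_smul_pair hw ht) (by
      intro i
      fin_cases i
      · exact ⟨hwΓ, hLw⟩
      · refine ⟨htΓ, ?_⟩
        change L (t • w) = 0
        rw [map_smul, hLw, smul_zero])
    simpa using this
  have hsum := finrank_map_add_finrank_inf_ker Γ (L : C2 →+ ℂ)
  have hle := finrank_inf_ker_le Γ hL0
  -- The kernel has rank exactly 2, so the image is free of rank 1, hence cyclic, although it was
  -- not known to be discrete. A preimage `γ` of its generator gives the complement ℤγ.
  have hI : finrank ℤ (Γ.map (L : C2 →+ ℂ)) = 1 := by omega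
  have := finite_map Γ (L : C2 →+ ℂ)
  let b := finBasisOfFinrankEq ℤ (Γ.map (L : C2 →+ ℂ)) hI
  obtain ⟨γ, hγ, hγb⟩ := (b 0).2
  set c := L γ with hc
  have hγb' : c = (b 0 : ℂ) := hγb
  have hc0 : c ≠ 0 := by
    rw [hγb']
    exact fun h => b.ne_zero 0 (Subtype.ext h)
  have hcyc : ∀ x ∈ Γ, ∃ n : ℤ, L x = n * c := by
    intro x hx
    have := b.sum_repr ⟨L x, x, hx, rfl⟩
    rw [Fin.sum_univ_one] at this
    refine ⟨b.repr ⟨L x, x, hx, rfl⟩ 0, ?_⟩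
    rw [hγb', ← zsmul_eq_mul]
    exact (congrArg Subtype.val this).symm
  set u : C2 →ₗ[ℂ] ℂ := c⁻¹ • L with hu
  set m : C2 →ₗ[ℂ] ℂ := N - (N γ) • u with hm
  have huγ : u γ = 1 := by simp [hu, ← hc, hc0]
  have huw : u w = 0 := by simp [hu, hLw]
  have hmγ : m γ = 0 := by simp [hm, huγ]
  have hmw : m w = 1 := by simp [hm, huw, hN]
  have hdec : ∀ v, v = u v • γ + m v • w := by
    intro v
    obtain ⟨s, hs⟩ := exists_eq_smul_of_detLeft_eq_zero hw
      (v := v - u v • γ) (by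
        rw [← hLdef, map_sub, map_smul, ← hc, hu, LinearMap.smul_apply, smul_eq_mul, smul_eq_mul,
          inv_mul_eq_div, div_mul_cancel₀ _ hc0, sub_self])
    have : m v = s := by
      have h1 := congrArg m hs
      simpa [hmγ, hmw] using h1
    rw [this, ← hs]
    abel
  let Λ : AddSubgroup ℂ := Γ.comap ((LinearMap.toSpanSingleton ℂ C2 w : ℂ →ₗ[ℂ] C2) : ℂ →+ C2)
  have hΛ (z : ℂ) : z ∈ Λ ↔ z • w ∈ Γ := by
    change (LinearMap.toSpanSingleton ℂ C2 w) z ∈ Γ ↔ _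
    simp
  have hdisc : DiscreteTopology Λ := by
    have hcont : Continuous (fun z : ℂ => z • w) := by fun_prop
    have hinj : Function.Injective (fun z : ℂ => z • w) := smul_left_injective ℂ hw
    have : DiscreteTopology ((fun z : ℂ => z • w) ⁻¹' (Γ : Set C2)) :=
      DiscreteTopology.preimage_of_continuous_injective (Γ : Set C2) hcont hinj
    have heq : (Λ : Set ℂ) = (fun z : ℂ => z • w) ⁻¹' (Γ : Set C2) := by
      ext z; exact hΛ z
    change DiscreteTopology (Λ : Set ℂ)
    rw [heq]; exact this
  have hspan : Submodule.span ℝ (Λ : Set ℂ) = ⊤ := by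
    have hli : LinearIndependent ℝ ![(1 : ℂ), t] :=
      (linearIndependent_pair_iff one_ne_zero).2 (by simpa using ht)
    rw [eq_top_iff, ← hli.span_eq_top_of_card_eq_finrank (by simp)]
    apply Submodule.span_mono
    rintro _ ⟨i, rfl⟩
    fin_cases i
    · exact (hΛ _).2 (by simpa using hwΓ)
    · exact (hΛ _).2 htΓ
  refine ⟨⟨Λ, hdisc, hspan⟩, γ, w, u, m, huγ, huw, hmγ, hmw, hdec, fun v => ⟨fun hv => ?_, ?_⟩⟩
  · obtain ⟨n, hn⟩ := hcyc v hv
    have hun : u v = n := by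
      rw [hu, LinearMap.smul_apply, hn, smul_eq_mul, mul_comm, mul_assoc, mul_inv_cancel₀ hc0,
        mul_one]
    refine ⟨⟨n, hun⟩, (hΛ _).2 ?_⟩
    have h1 : m v • w = v - n • γ := by
      rw [← Int.cast_smul_eq_zsmul ℂ, ← hun]
      exact eq_sub_of_add_eq' (hdec v).symm
    rw [h1]
    exact Γ.sub_mem hv (Γ.zsmul_mem hγ n)
  · rintro ⟨⟨n, hn⟩, hmem⟩
    rw [hdec v, hn, Int.cast_smul_eq_zsmul]
    exact Γ.add_mem (Γ.zsmul_mem hγ n) ((hΛ _).1 hmem)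

theorem HasEllipticLine.splits {Γ : AddSubgroup C2} [DiscreteTopology Γ]
    (hrank : finrank ℤ Γ = 3) (h : HasEllipticLine Γ) : Splits Γ := by
  obtain ⟨E, γ, w, u, m, huγ, huw, hmγ, hmw, hdec, hΓ⟩ := h.exists_decomposition hrank
  have hπ : (2 * Real.pi * Complex.I : ℂ) ≠ 0 := Complex.two_pi_I_ne_zero
  -- The coordinate `u` is integral on `Γ`, so exp(2πiu) turns it into the factor ℂ*.
  let Φ : C2 → ℂˣ × E.Points := fun v =>
    (Units.mk0 (Complex.exp (2 * Real.pi * Complex.I * u v)) (Complex.exp_ne_zero _),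
      (m v : E.Points))
  have hΦ (v v' : C2) : Φ v = Φ v' ↔ -v + v' ∈ Γ := by
    rw [hΓ, Prod.ext_iff, Units.ext_iff]
    refine and_congr ?_ ?_
    · simp only [Φ, Units.val_mk0, map_add, map_neg]
      rw [eq_comm, Complex.exp_eq_exp_iff_exists_int]
      refine exists_congr fun n => ⟨fun h => ?_, fun h => ?_⟩
      · apply mul_left_cancel₀ hπ
        linear_combination h
      · linear_combination (2 * Real.pi * Complex.I : ℂ) * h
    · simp only [Φ]
      rw [QuotientAddGroup.eq, map_add, map_neg]
  have hΦadd (v v' : C2) : Φ (v + v') = ((Φ v).1 * (Φ v').1, (Φ v).2 + (Φ v').2) := by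
    refine Prod.ext (Units.ext ?_) ?_
    · simp [Φ, mul_add, Complex.exp_add]
    · simp [Φ]
  have hσ (a b : ℂ) : u (a • γ + b • w) = a ∧ m (a • γ + b • w) = b := by
    simp [huγ, huw, hmγ, hmw]
  let f : C2 ⧸ Γ → ℂˣ × E.Points := Quotient.lift Φ fun v v' hvv' =>
    (hΦ v v').2 (QuotientAddGroup.leftRel_apply.1 hvv')
  have hf (v : C2) : f (v : C2 ⧸ Γ) = Φ v := rfl
  have hbij : Function.Bijective f := by
    constructor
    · intro x y hxy
      obtain ⟨v, rfl⟩ := QuotientAddGroup.mk_surjective x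
      obtain ⟨v', rfl⟩ := QuotientAddGroup.mk_surjective y
      rw [hf, hf, hΦ] at hxy
      exact QuotientAddGroup.eq.2 hxy
    · rintro ⟨z, e⟩
      obtain ⟨b, rfl⟩ := QuotientAddGroup.mk_surjective e
      refine ⟨((Complex.log z / (2 * Real.pi * Complex.I)) • γ + b • w : C2), ?_⟩
      rw [hf]
      refine Prod.ext (Units.ext ?_) ?_
      · simp only [Φ, Units.val_mk0, (hσ _ _).1]
        rw [mul_div_cancel₀ _ hπ, Complex.exp_log z.ne_zero]
      · simp only [Φ, (hσ _ _).2]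
  let φ : C2 ⧸ Γ ≃ ℂˣ × E.Points := Equiv.ofBijective f hbij
  have hφ (v : C2) : φ (v : C2 ⧸ Γ) = Φ v := rfl
  refine ⟨E, φ, ?_, ?_, ?_⟩
  · intro x y
    obtain ⟨v, rfl⟩ := QuotientAddGroup.mk_surjective x
    obtain ⟨v', rfl⟩ := QuotientAddGroup.mk_surjective y
    rw [← QuotientAddGroup.mk_add, hφ, hφ, hφ, hΦadd]
  · apply mdifferentiable_of_comp_mk
    refine MDifferentiable.prodMk (mdifferentiable_units_of_val ?_) ?_
    · have : Differentiable ℂ u := (LinearMap.toContinuousLinearMap u).differentiable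
      change Differentiable ℂ fun v => Complex.exp (2 * Real.pi * Complex.I * u v)
      fun_prop
    · have h1 : MDifferentiable 𝓘(ℂ, C2) 𝓘(ℂ, ℂ) m :=
        (LinearMap.toContinuousLinearMap m).differentiable.mdifferentiable
      exact (mdifferentiable_mk E.lattice).comp h1
  · apply mdifferentiable_symm_of_localSection
    rintro ⟨z₀, e₀⟩
    obtain ⟨b₀, rfl⟩ := QuotientAddGroup.mk_surjective e₀
    obtain ⟨τ, -, hτ, hτd⟩ := exists_localSection E.lattice b₀
    -- Dividing by `z₀` first keeps the logarithm away from its branch cut near `z₀`.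
    let ℓ : ℂ → ℂ := fun z =>
      (Complex.log (z / z₀) + Complex.log z₀) / (2 * Real.pi * Complex.I)
    refine ⟨fun p => ℓ p.1 • γ + τ p.2 • w, ?_, ?_⟩
    · have h1 : MDifferentiableAt (𝓘(ℂ, ℂ).prod 𝓘(ℂ, ℂ)) 𝓘(ℂ, ℂ)
          (fun p : ℂˣ × E.Points => ℓ p.1) (z₀, (b₀ : E.Points)) := by
        have hℓ : DifferentiableAt ℂ ℓ (z₀ : ℂ) := by
          have : (z₀ / z₀ : ℂ) ∈ Complex.slitPlane := by
            rw [div_self z₀.ne_zero]; exact Complex.one_mem_slitPlane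
          have h2 : DifferentiableAt ℂ (fun z : ℂ => z / z₀) (z₀ : ℂ) := by fun_prop
          exact ((h2.clog this).add_const _).div_const _
        have hval : MDifferentiableAt 𝓘(ℂ, ℂ) 𝓘(ℂ, ℂ) (Units.val : ℂˣ → ℂ) z₀ :=
          (Units.contMDiff_val (n := 1) z₀).mdifferentiableAt one_ne_zero
        have hfst : MDifferentiableAt (𝓘(ℂ, ℂ).prod 𝓘(ℂ, ℂ)) 𝓘(ℂ, ℂ)
            (Prod.fst : ℂˣ × E.Points → ℂˣ) (z₀, (b₀ : E.Points)) := mdifferentiableAt_fst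
        exact hℓ.mdifferentiableAt.comp (z₀, (b₀ : E.Points))
          (hval.comp (z₀, (b₀ : E.Points)) hfst)
      have h2 : MDifferentiableAt (𝓘(ℂ, ℂ).prod 𝓘(ℂ, ℂ)) 𝓘(ℂ, ℂ)
          (fun p : ℂˣ × E.Points => τ p.2) (z₀, (b₀ : E.Points)) :=
        hτd.self_of_nhds.comp (z₀, (b₀ : E.Points)) mdifferentiableAt_snd
      have h3 : Differentiable ℂ (fun q : ℂ × ℂ => q.1 • γ + q.2 • w) := by fun_prop
      exact (h3.mdifferentiable _).comp (z₀, (b₀ : E.Points)) (h1.prodMk_space h2)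
    · have hev : ∀ᶠ p : ℂˣ × E.Points in 𝓝 (z₀, (b₀ : E.Points)), (τ p.2 : E.Points) = p.2 :=
        (continuous_snd.tendsto (z₀, (b₀ : E.Points))).eventually hτ
      filter_upwards [hev] with p hp
      rw [hφ]
      refine Prod.ext (Units.ext ?_) ?_
      · simp only [Φ, Units.val_mk0, (hσ _ _).1, ℓ]
        rw [mul_div_cancel₀ _ hπ, Complex.exp_add,
          Complex.exp_log (div_ne_zero p.1.ne_zero z₀.ne_zero), Complex.exp_log z₀.ne_zero,
          div_mul_cancel₀ _ z₀.ne_zero]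
      · simp only [Φ, (hσ _ _).2, hp]

/-! ### Part (a): normal form of `Γ` and the arithmetic of isogenies -/

/-- If `a` and `b` were both real, `g k` would be a real combination of `g i` and `g j`. -/
theorem exists_coordinates_of_detLeft_ne_zero {g : Fin 3 → C2} (hg : LinearIndependent ℝ g)
    {i j k : Fin 3} (hik : i ≠ k) (hjk : j ≠ k) (hdet : detLeft (g i) (g j) ≠ 0) :
    ∃ (A : C2 ≃ₗ[ℂ] C2) (a b : ℂ), A (g i) = ![1, 0] ∧ A (g j) = ![0, 1] ∧ A (g k) = ![a, b] ∧
      (a.im ≠ 0 ∨ b.im ≠ 0) := by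
  have hli : LinearIndependent ℂ ![g i, g j] := by
    rw [LinearIndependent.pair_iff' (hg.ne_zero i)]
    rintro t ht
    apply hdet
    rw [← ht]
    simp only [detLeft_apply, Pi.smul_apply, smul_eq_mul]
    ring
  let B := basisOfLinearIndependentOfCardEqFinrank hli (by simp)
  have hBi : B.equivFun (g i) = ![1, 0] := by
    have h : B 0 = g i := by simp [B]
    ext x; rw [← h, Basis.equivFun_self]
    fin_cases x <;> simp
  have hBj : B.equivFun (g j) = ![0, 1] := by
    have h : B 1 = g j := by simp [B]
    ext x; rw [← h, Basis.equivFun_self]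
    fin_cases x <;> simp
  refine ⟨B.equivFun, B.equivFun (g k) 0, B.equivFun (g k) 1, hBi, hBj, ?_, ?_⟩
  · ext x; fin_cases x <;> rfl
  · by_contra! h
    obtain ⟨h0, h1⟩ := h
    set a := B.equivFun (g k) 0
    set b := B.equivFun (g k) 1
    have hk : g k = a.re • g i + b.re • g j := by
      apply B.equivFun.injective
      have e0 : ((a.re : ℝ) : ℂ) = a := by apply Complex.ext <;> simp [h0]
      have e1 : ((b.re : ℝ) : ℂ) = b := by apply Complex.ext <;> simp [h1]
      rw [← Complex.coe_smul, ← Complex.coe_smul, e0, e1, map_add, map_smul, map_smul, hBi, hBj]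
      ext x; fin_cases x <;> simp [a, b]
    rw [Fintype.linearIndependent_iff] at hg
    have := hg (Pi.single k 1 - a.re • Pi.single i 1 - b.re • Pi.single j 1) (by
      simp only [Pi.sub_apply, Pi.smul_apply, sub_smul, Finset.sum_sub_distrib, smul_eq_mul,
        mul_smul, Pi.single_apply, ite_smul, one_smul, zero_smul, smul_ite, smul_zero,
        Finset.sum_ite_eq', Finset.mem_univ, if_true]
      rw [hk]; abel) k
    simp [hik.symm, hjk.symm] at this

/-- In suitable linear coordinates, `Γ` is generated by `(1, 0)`, `(0, 1)` and a vector `(a, b)`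
with `b` not real. -/
theorem exists_coordinates (Γ : AddSubgroup C2) [DiscreteTopology Γ] (hrank : finrank ℤ Γ = 3) :
    ∃ (A : C2 ≃ₗ[ℂ] C2) (a b : ℂ), b.im ≠ 0 ∧
      ∀ γ, γ ∈ Γ ↔ ∃ x y z : ℤ, A γ = ![x + z * a, y + z * b] := by
  have hex := exists_real_basis Γ
  rw [hrank] at hex
  obtain ⟨g, hg, hspan⟩ := hex
  have hmem (γ : C2) : γ ∈ Γ ↔ ∃ n : Fin 3 → ℤ, ∑ i, n i • g i = γ := by
    rw [← Submodule.mem_span_range_iff_exists_fun, hspan]; rfl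
  have key : ∀ i j k : Fin 3, i ≠ j → i ≠ k → j ≠ k → detLeft (g i) (g j) ≠ 0 →
      ∃ (A : C2 ≃ₗ[ℂ] C2) (i j k : Fin 3) (a b : ℂ), i ≠ j ∧ i ≠ k ∧ j ≠ k ∧
        A (g i) = ![1, 0] ∧ A (g j) = ![0, 1] ∧ A (g k) = ![a, b] ∧ b.im ≠ 0 := by
    intro i j k hij hik hjk hdet
    obtain ⟨A, a, b, hi, hj, hk, hab⟩ := exists_coordinates_of_detLeft_ne_zero hg hik hjk hdet
    rcases hab with ha | hb
    -- Swapping the coordinates moves the non-real entry to the second place.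
    · refine ⟨A.trans (LinearEquiv.funCongrLeft ℂ ℂ (Equiv.swap 0 1)), j, i, k, b, a, hij.symm,
        hjk, hik, ?_, ?_, ?_, ha⟩
      all_goals
        simp only [LinearEquiv.trans_apply, hi, hj, hk]
        ext x; fin_cases x <;> simp [LinearEquiv.funCongrLeft_apply, LinearMap.funLeft_apply]
    · exact ⟨A, i, j, k, a, b, hij, hik, hjk, hi, hj, hk, hb⟩
  obtain ⟨A, i, j, k, a, b, hij, hik, hjk, hi, hj, hk, hb⟩ : ∃ (A : C2 ≃ₗ[ℂ] C2) (i j k : Fin 3)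
      (a b : ℂ), i ≠ j ∧ i ≠ k ∧ j ≠ k ∧
        A (g i) = ![1, 0] ∧ A (g j) = ![0, 1] ∧ A (g k) = ![a, b] ∧ b.im ≠ 0 := by
    by_cases h1 : detLeft (g 0) (g 1) = 0
    · by_cases h2 : detLeft (g 0) (g 2) = 0
      -- Otherwise all of `Γ` lies on the complex line of `g 0` and has rank at most 2.
      · exfalso
        have hL : detLeft (g 0) ≠ 0 := by
          intro h0
          apply hg.ne_zero 0
          have e1 := LinearMap.congr_fun h0 (Pi.single 0 1)
          have e2 := LinearMap.congr_fun h0 (Pi.single 1 1)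
          ext i
          fin_cases i
          · simpa using e2
          · simpa using e1
        have hle := finrank_inf_ker_le Γ hL
        have : Γ ⊓ ((detLeft (g 0) : C2 →ₗ[ℂ] ℂ) : C2 →+ ℂ).ker = Γ := by
          refine inf_eq_left.2 fun γ hγ => ?_
          obtain ⟨n, rfl⟩ := (hmem γ).1 hγ
          change detLeft (g 0) _ = 0
          have h0 : detLeft (g 0) (g 0) = 0 := by simp [mul_comm]
          simp only [Fin.sum_univ_three, map_add, map_zsmul, h0, h1, h2, smul_zero, add_zero]
        rw [this, hrank] at hle
        omega
      · exact key 0 2 1 (by decide) (by decide) (by decide) h2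
    · exact key 0 1 2 (by decide) (by decide) (by decide) h1
  have huniv : (Finset.univ : Finset (Fin 3)) = {i, j, k} := by
    symm
    apply Finset.eq_univ_of_card
    rw [Finset.card_eq_three.2 ⟨i, j, k, hij, hik, hjk, rfl⟩, Fintype.card_fin]
  have hsum (n : Fin 3 → ℤ) : A (∑ l, n l • g l) = ![n i + n k * a, n j + n k * b] := by
    rw [huniv, Finset.sum_insert (by simp [hij, hik]), Finset.sum_insert (by simp [hjk]),
      Finset.sum_singleton]
    simp only [map_add, map_zsmul, hi, hj, hk]
    ext x; fin_cases x <;> simp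
  refine ⟨A, a, b, hb, fun γ => (hmem γ).trans ⟨?_, ?_⟩⟩
  · rintro ⟨n, rfl⟩
    exact ⟨n i, n j, n k, hsum n⟩
  · rintro ⟨x, y, z, h⟩
    refine ⟨fun l => if l = i then x else if l = j then y else z, A.injective ?_⟩
    rw [hsum, h]
    simp [hij.symm, hik.symm, hjk.symm]

/-- A functional mapping `Γ` onto a lattice induces a surjection onto an elliptic curve with
connected kernel. -/
theorem exists_surjection_of_functional (Γ : AddSubgroup C2) [DiscreteTopology Γ]
    (L : C2 →ₗ[ℂ] ℂ) (E : EllipticCurve) (hL : ∀ x, x ∈ E.lattice ↔ ∃ γ ∈ Γ, L γ = x) :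
    ∃ f : C2 ⧸ Γ →+ E.Points, IsHolomorphicSurjection Γ E f ∧
      IsConnected (f.ker : Set (C2 ⧸ Γ)) := by
  obtain ⟨f, hf, hfL⟩ := exists_hom_of_linear Γ E.lattice (LinearMap.toContinuousLinearMap L)
    fun γ hγ => (hL _).2 ⟨γ, hγ, rfl⟩
  simp only [LinearMap.coe_toContinuousLinearMap'] at hfL
  have hL0 : L ≠ 0 := by
    rintro rfl
    have hbot : E.lattice = ⊥ := by
      rw [eq_bot_iff]
      intro x hx
      obtain ⟨γ, -, h⟩ := (hL x).1 hx
      exact h.symm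
    have h2 := E.finrank_lattice
    rw [hbot, finrank_zero_of_subsingleton] at h2
    omega
  refine ⟨f, ⟨hf, fun y => ?_⟩, ?_⟩
  · obtain ⟨z, rfl⟩ := QuotientAddGroup.mk_surjective y
    obtain ⟨v, rfl⟩ := LinearMap.surjective hL0 z
    exact ⟨v, hfL v⟩
  -- Since `L` maps `Γ` onto the whole lattice, the kernel is the image of the single subspace `ker
  -- L`.
  · have hker : (f.ker : Set (C2 ⧸ Γ)) = (QuotientAddGroup.mk : C2 → C2 ⧸ Γ) '' (LinearMap.ker L) := by
      ext q
      obtain ⟨v, rfl⟩ := QuotientAddGroup.mk_surjective q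
      rw [SetLike.mem_coe, AddMonoidHom.mem_ker, hfL, QuotientAddGroup.eq_zero_iff, hL]
      constructor
      · rintro ⟨γ, hγ, h⟩
        refine ⟨v - γ, by simp [h], ?_⟩
        rw [QuotientAddGroup.mk_sub, (QuotientAddGroup.eq_zero_iff γ).2 hγ, sub_zero]
      · rintro ⟨u, hu, h⟩
        rw [QuotientAddGroup.eq] at h
        exact ⟨-u + v, h, by rw [map_add, map_neg, LinearMap.mem_ker.1 hu, neg_zero, zero_add]⟩
    rw [hker]
    refine IsConnected.image ⟨⟨0, Submodule.zero_mem _⟩, ?_⟩ _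
      QuotientAddGroup.continuous_mk.continuousOn
    exact ((LinearMap.ker L).restrictScalars ℝ).convex.isPreconnected

/-- The arithmetic relations that isogenies impose on the coordinates of `Γ`. -/
theorem linear_or_cubic_of_moebius {a b : ℂ} (hb : b.im ≠ 0)
    (H : ∀ x y : ℤ, ((a + x) / (b + y)).im ≠ 0 → ∃ p q r s : ℤ, (p * b + q : ℂ) ≠ 0 ∧
      (a + x) * (p * b + q) = (b + y) * (r * b + s)) :
    (∃ p r s : ℤ, p ≠ 0 ∧ a * p = r * b + s) ∨
      (finrank ℚ (IntermediateField.adjoin ℚ {b}) = 3 ∧ a ∈ IntermediateField.adjoin ℚ {b}) := by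
  have hby (y : ℤ) : (b + y).im ≠ 0 := by simpa using hb
  have hby0 (y : ℤ) : b + y ≠ 0 := fun h => hby y (by rw [h]; rfl)
  -- Two values of x change the quotient by a nonzero real multiple of 1/(b+y), which is not real.
  have hbad (y : ℤ) : {x : ℤ | ((a + x) / (b + y)).im = 0}.Subsingleton := by
    intro x hx x' hx'
    by_contra hne
    have h1 : (((x - x' : ℝ) : ℂ) / (b + y)).im = 0 := by
      have : ((x - x' : ℝ) : ℂ) / (b + y) = (a + x) / (b + y) - (a + x') / (b + y) := by
        push_cast; ring
      rw [this, Complex.sub_im, hx, hx', sub_zero]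
    rw [div_eq_mul_inv, Complex.im_ofReal_mul, Complex.inv_im] at h1
    rcases mul_eq_zero.1 h1 with h2 | h2
    · exact hne (by exact_mod_cast sub_eq_zero.1 h2)
    · rcases div_eq_zero_iff.1 h2 with h3 | h3
      · exact hby y (neg_eq_zero.1 h3)
      · exact hby0 y (Complex.normSq_eq_zero.1 h3)
  obtain ⟨x₀, hx₀⟩ := (hbad 0).finite.exists_notMem
  obtain ⟨p, q, r, s, hpq, h0⟩ := H x₀ 0 hx₀
  rw [Int.cast_zero, add_zero] at h0
  by_cases hind : ∀ c₀ c₁ c₂ c₃ : ℤ, (c₀ + c₁ * b + c₂ * b ^ 2 + c₃ * b ^ 3 : ℂ) = 0 →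
      c₀ = 0 ∧ c₁ = 0 ∧ c₂ = 0 ∧ c₃ = 0
  · left
    obtain ⟨y, hy⟩ : ∃ y : ℤ, q - p * y ≠ 0 := by
      by_contra! h
      have h1 := h 0
      have h2 := h 1
      apply hpq
      have hq : q = 0 := by simpa using h1
      have hp : p = 0 := by simpa [hq] using h2
      simp [hp, hq]
    -- This equation, linear in `x`, is the case to avoid: for other `x` the first factor in `hroot`
    -- is nonzero.
    have hsub : {x : ℤ | (x - x₀) * (q - p * y) = y * (s - r * y)}.Subsingleton := by
      intro x hx x' hx'
      have : (x - x₀) * (q - p * y) = (x' - x₀) * (q - p * y) := hx.trans hx'.symm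
      have := mul_right_cancel₀ hy this
      omega
    obtain ⟨x, hx⟩ := ((hbad y).finite.union hsub.finite).exists_notMem
    simp only [Set.mem_union, Set.mem_ofPred_eq, not_or] at hx
    obtain ⟨hx1, hx2⟩ := hx
    obtain ⟨p', q', r', s', hpq', h1⟩ := H x y hx1
    -- Eliminating `a` leaves a cubic identity in `b`, which by independence holds identically.
    -- Putting -y for `b` kills the right side, so `q' = p' * y` and the factor b+y cancels from the
    -- second relation.
    have hrel : ((x - x₀) * (p * b + q) + b * (r * b + s)) * (p' * b + q') =
        (p * b + q) * ((b + y) * (r' * b + s')) := by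
      rw [← h1, ← h0]; ring
    obtain ⟨e0, e1, e2, e3⟩ := hind
      ((x - x₀) * q * q' - q * y * s')
      (((x - x₀) * p + s) * q' + (x - x₀) * q * p' - (p * y * s' + q * s' + q * y * r'))
      (r * q' + ((x - x₀) * p + s) * p' - (p * s' + p * y * r' + q * r'))
      (r * p' - p * r') (by push_cast; linear_combination hrel)
    have hroot : ((x - x₀) * (q - p * y) - y * (s - r * y)) * (q' - p' * y) = 0 := by
      linear_combination e0 - y * e1 + y ^ 2 * e2 - y ^ 3 * e3
    have hq' : q' = p' * y :=
      sub_eq_zero.1 ((mul_eq_zero.1 hroot).resolve_left (sub_ne_zero.2 hx2))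
    have hp' : p' ≠ 0 := by
      rintro rfl
      apply hpq'
      simp [hq']
    refine ⟨p', r', s' - p' * x, hp', ?_⟩
    apply mul_left_cancel₀ (hby0 y)
    rw [hq'] at h1
    push_cast at h1 ⊢
    linear_combination h1
  · push Not at hind
    obtain ⟨c₀, c₁, c₂, c₃, hc, hne⟩ := hind
    set P : Polynomial ℚ := Polynomial.C (c₃ : ℚ) * Polynomial.X ^ 3 +
      Polynomial.C (c₂ : ℚ) * Polynomial.X ^ 2 + Polynomial.C (c₁ : ℚ) * Polynomial.X +
      Polynomial.C (c₀ : ℚ) with hP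
    have hP0 : P ≠ 0 := by
      intro h
      have h' : (⟨c₃, c₂, c₁, c₀⟩ : Cubic ℚ) = 0 := (Cubic.toPoly_eq_zero_iff _).1 h
      have k0 : (c₀ : ℚ) = 0 := congrArg Cubic.d h'
      have k1 : (c₁ : ℚ) = 0 := congrArg Cubic.c h'
      have k2 : (c₂ : ℚ) = 0 := congrArg Cubic.b h'
      have k3 : (c₃ : ℚ) = 0 := congrArg Cubic.a h'
      exact hne (by exact_mod_cast k0) (by exact_mod_cast k1) (by exact_mod_cast k2)
        (by exact_mod_cast k3)
    have hPb : Polynomial.aeval b P = 0 := by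
      simp only [hP, map_add, map_mul, Polynomial.aeval_C, Polynomial.aeval_X, map_pow]
      simp only [eq_ratCast, Rat.cast_intCast]
      linear_combination hc
    have hPdeg : P.natDegree ≤ 3 := Polynomial.natDegree_cubic_le
    have hint : IsIntegral ℚ b := IsAlgebraic.isIntegral ⟨P, hP0, hPb⟩
    have hdeg : (minpoly ℚ b).natDegree ≤ 3 :=
      (Polynomial.natDegree_le_natDegree (minpoly.degree_le_of_ne_zero ℚ b hP0 hPb)).trans hPdeg
    set K := IntermediateField.adjoin ℚ {b} with hK
    have hbK : b ∈ K := IntermediateField.mem_adjoin_simple_self ℚ b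
    have hint' (n : ℤ) : (n : ℂ) ∈ K := K.intCast_mem n
    have haK : a ∈ K := by
      have : a = b * (r * b + s) / (p * b + q) - x₀ := by
        rw [eq_sub_iff_add_eq, eq_div_iff hpq, h0]
      rw [this]
      refine K.sub_mem (K.div_mem (K.mul_mem hbK ?_) ?_) (hint' _)
      · exact K.add_mem (K.mul_mem (hint' _) hbK) (hint' _)
      · exact K.add_mem (K.mul_mem (hint' _) hbK) (hint' _)
    have hfr : finrank ℚ K = (minpoly ℚ b).natDegree := IntermediateField.adjoin.finrank hint
    by_cases h3 : finrank ℚ K = 3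
    · exact Or.inr ⟨h3, haK⟩
    -- Here `b` has degree at most 2, so every element of ℚ(b), in particular `a`, is a linear
    -- polynomial in `b`.
    · left
      obtain ⟨f, hfdeg, hf⟩ := (IntermediateField.adjoin.powerBasis hint).exists_eq_aeval ⟨a, haK⟩
      rw [IntermediateField.adjoin.powerBasis_dim] at hfdeg
      rw [IntermediateField.adjoin.powerBasis_gen] at hf
      obtain ⟨u, v, rfl⟩ := Polynomial.exists_eq_X_add_C_of_natDegree_le_one
        (show f.natDegree ≤ 1 by omega)
      have hf' : a = u * b + v := by
        have := congrArg Subtype.val hf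
        simpa using this
      refine ⟨u.den * v.den, u.num * v.den, v.num * u.den, by positivity, ?_⟩
      have hu : (u.den : ℂ) ≠ 0 := by exact_mod_cast u.den_ne_zero
      have hv : (v.den : ℂ) ≠ 0 := by exact_mod_cast v.den_ne_zero
      rw [hf', Rat.cast_def u, Rat.cast_def v]
      push_cast
      field_simp

theorem splits_or_isCubic (Γ : AddSubgroup C2) [DiscreteTopology Γ] (hrank : finrank ℤ Γ = 3)
    (H : ∀ (E E' : EllipticCurve) (f : C2 ⧸ Γ →+ E.Points) (f' : C2 ⧸ Γ →+ E'.Points),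
      IsHolomorphicSurjection Γ E f → IsConnected (f.ker : Set (C2 ⧸ Γ)) →
      IsHolomorphicSurjection Γ E' f' → IsConnected (f'.ker : Set (C2 ⧸ Γ)) →
      Isogenous E E') : Splits Γ ∨ IsCubic Γ := by
  obtain ⟨A, a, b, hb, hΓ⟩ := exists_coordinates Γ hrank
  let α : C2 →ₗ[ℂ] ℂ := LinearMap.proj 0 ∘ₗ (A : C2 →ₗ[ℂ] C2)
  let β : C2 →ₗ[ℂ] ℂ := LinearMap.proj 1 ∘ₗ (A : C2 →ₗ[ℂ] C2)
  have hα (v : C2) : α v = A v 0 := rfl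
  have hβ (v : C2) : β v = A v 1 := rfl
  have hli : LinearIndependent ℝ ![1, b] :=
    (linearIndependent_pair_iff one_ne_zero).2 (by simpa using hb)
  obtain ⟨f', hf', hc'⟩ := exists_surjection_of_functional Γ β (EllipticCurve.ofPair hli) (by
    intro x
    rw [EllipticCurve.mem_ofPair_lattice]
    constructor
    · rintro ⟨m, n, rfl⟩
      refine ⟨A.symm ![((0 : ℤ) : ℂ) + n * a, m + n * b], (hΓ _).2 ⟨0, m, n, by simp⟩, ?_⟩
      rw [hβ, LinearEquiv.apply_symm_apply]
      simp
    · rintro ⟨γ, hγ, rfl⟩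
      obtain ⟨x, y, z, h⟩ := (hΓ γ).1 hγ
      exact ⟨y, z, by rw [hβ, h]; simp⟩)
  have hmoeb : ∀ x y : ℤ, ((a + x) / (b + y)).im ≠ 0 → ∃ p q r s : ℤ, (p * b + q : ℂ) ≠ 0 ∧
      (a + x) * (p * b + q) = (b + y) * (r * b + s) := by
    intro x y hxy
    have hby0 : b + y ≠ 0 := by
      intro h; rw [h] at hxy; simp at hxy
    have hli' : LinearIndependent ℝ ![b + y, a + x] := (linearIndependent_pair_iff hby0).2 hxy
    -- This functional kills (a+x, b+y). It sends (1,0) to -(b+y), (0,1) to a+x, and (a,b) to x(b+y)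
    -- - y(a+x), so its image on `Γ` is the lattice of these two periods.
    obtain ⟨f, hf, hc⟩ := exists_surjection_of_functional Γ ((a + x) • β - (b + y) • α)
      (EllipticCurve.ofPair hli') (by
        intro t
        rw [EllipticCurve.mem_ofPair_lattice]
        constructor
        · rintro ⟨m, n, rfl⟩
          refine ⟨A.symm ![((-m : ℤ) : ℂ) + (0 : ℤ) * a, n + (0 : ℤ) * b],
            (hΓ _).2 ⟨-m, n, 0, by simp⟩, ?_⟩
          rw [LinearMap.sub_apply, LinearMap.smul_apply, LinearMap.smul_apply, hα, hβ,
            LinearEquiv.apply_symm_apply]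
          simp
          ring
        · rintro ⟨γ, hγ, rfl⟩
          obtain ⟨X, Y, Z, h⟩ := (hΓ γ).1 hγ
          refine ⟨-(X - x * Z), Y - y * Z, ?_⟩
          rw [LinearMap.sub_apply, LinearMap.smul_apply, LinearMap.smul_apply, hα, hβ, h]
          simp
          ring)
    obtain ⟨c, hc0, hcmem⟩ := (H _ _ f f' hf hc hf' hc').exists_mul
    obtain ⟨q, p, h1⟩ := (EllipticCurve.mem_ofPair_lattice hli).1
      (hcmem (b + y) ((EllipticCurve.mem_ofPair_lattice hli').2 ⟨1, 0, by simp⟩))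
    obtain ⟨s, r, h2⟩ := (EllipticCurve.mem_ofPair_lattice hli).1
      (hcmem (a + x) ((EllipticCurve.mem_ofPair_lattice hli').2 ⟨0, 1, by simp⟩))
    have h1' : (p * b + q : ℂ) = c * (b + y) := by rw [← h1]; ring
    have h2' : (r * b + s : ℂ) = c * (a + x) := by rw [← h2]; ring
    refine ⟨p, q, r, s, ?_, ?_⟩
    · rw [h1']; exact mul_ne_zero hc0 hby0
    · rw [h1', h2']; ring
  rcases linear_or_cubic_of_moebius hb hmoeb with ⟨p, r, s, hp, hps⟩ | ⟨hdeg, ha⟩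
  · left
    -- The relation gives b·(r,p) = p·(a,b) - s·(1,0), so (r,p) and its non-real multiple both lie
    -- in `Γ`.
    refine HasEllipticLine.splits hrank ⟨A.symm ![(r : ℂ), p], b, ?_, hb, ?_, ?_⟩
    · rw [Ne, LinearEquiv.map_eq_zero_iff]
      intro h
      have := congrFun h 1
      simp at this
      exact hp this
    · exact (hΓ _).2 ⟨r, p, 0, by simp⟩
    · refine (hΓ _).2 ⟨-s, 0, p, ?_⟩
      rw [map_smul, LinearEquiv.apply_symm_apply]
      ext i; fin_cases i
      · simp
        linear_combination -hps
      · simp [mul_comm]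
  · right
    refine ⟨IntermediateField.adjoin ℚ {b}, hdeg, A, fun γ hγ i => ?_⟩
    obtain ⟨x, y, z, h⟩ := (hΓ γ).1 hγ
    have hbK := IntermediateField.mem_adjoin_simple_self ℚ b
    set K := IntermediateField.adjoin ℚ {b}
    have hint (n : ℤ) : (n : ℂ) ∈ K := K.intCast_mem n
    rw [h]
    fin_cases i
    · exact K.add_mem (hint _) (K.mul_mem (hint _) ha)
    · exact K.add_mem (hint _) (K.mul_mem (hint _) hbK)

/-! ### Part (b): all admissible elliptic quotients are isogenous -/

theorem IsHolomorphicSurjection.exists_functional {Γ : AddSubgroup C2} [DiscreteTopology Γ]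
    {E : EllipticCurve} {f : C2 ⧸ Γ →+ E.Points} (hf : IsHolomorphicSurjection Γ E f) :
    ∃ D : C2 →L[ℂ] ℂ, (D : C2 →ₗ[ℂ] ℂ) ≠ 0 ∧ (∀ v : C2, f v = (D v : E.Points)) ∧
      ∀ γ ∈ Γ, D γ ∈ E.lattice := by
  obtain ⟨D, hD⟩ := exists_linear_lift Γ E.lattice f hf.1
  refine ⟨D, fun h0 => ?_, hD, fun γ hγ => ?_⟩
  · obtain ⟨y, hy⟩ := EllipticCurve.Points.exists_ne_zero E
    obtain ⟨x, rfl⟩ := hf.2 y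
    obtain ⟨v, rfl⟩ := QuotientAddGroup.mk_surjective x
    apply hy
    have : D v = 0 := LinearMap.congr_fun h0 v
    rw [hD, this, QuotientAddGroup.mk_zero]
  · rw [← QuotientAddGroup.eq_zero_iff, ← hD, (QuotientAddGroup.eq_zero_iff γ).2 hγ, map_zero]

/-- If the kernel of `C² / Γ → E` has finitely many components, then the image of `Γ` has finite
index in the lattice of `E`. -/
theorem exists_nat_smul_mem_map_of_finite_components {Γ : AddSubgroup C2} [DiscreteTopology Γ]
    {E : EllipticCurve} {f : C2 ⧸ Γ →+ E.Points} {D : C2 →L[ℂ] ℂ}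
    (hD0 : (D : C2 →ₗ[ℂ] ℂ) ≠ 0) (hD : ∀ v : C2, f v = (D v : E.Points))
    (hfin : Finite (ConnectedComponents f.ker)) :
    ∃ n : ℕ, n ≠ 0 ∧ ∀ x ∈ E.lattice, n • x ∈ Γ.map (D : C2 →+ ℂ) := by
  set J : AddSubgroup E.lattice := (Γ.map (D : C2 →+ ℂ)).addSubgroupOf E.lattice with hJ
  have hmem (v : C2) : (v : C2 ⧸ Γ) ∈ f.ker ↔ D v ∈ E.lattice := by
    rw [AddMonoidHom.mem_ker, hD, QuotientAddGroup.eq_zero_iff]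
  let lift : f.ker → C2 := fun q => Quotient.out (q : C2 ⧸ Γ)
  have hlift (q : f.ker) : ((lift q : C2) : C2 ⧸ Γ) = q := QuotientAddGroup.out_eq' _
  have hlift' (q : f.ker) : D (lift q) ∈ E.lattice := (hmem _).1 (by rw [hlift]; exact q.2)
  -- The class of `D v` modulo `D(Γ)` is a continuous surjection from the kernel to a discrete
  -- group, so it factors through the components. The choice of lift does not matter.
  let g : f.ker → E.lattice ⧸ J := fun q => ((⟨D (lift q), hlift' q⟩ : E.lattice) : E.lattice ⧸ J)
  have hg (v : C2) (hv : (v : C2 ⧸ Γ) ∈ f.ker) :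
      g ⟨v, hv⟩ = ((⟨D v, (hmem v).1 hv⟩ : E.lattice) : E.lattice ⧸ J) := by
    refine QuotientAddGroup.eq.2 ?_
    have h1 : -(lift ⟨v, hv⟩) + v ∈ Γ := QuotientAddGroup.eq.1 (hlift ⟨v, hv⟩)
    rw [hJ, AddSubgroup.mem_addSubgroupOf]
    exact ⟨_, h1, by simp⟩
  have hcont : Continuous g := by
    have hq : IsOpenQuotientMap (Set.restrictPreimage (f.ker : Set (C2 ⧸ Γ))
        (QuotientAddGroup.mk : C2 → C2 ⧸ Γ)) :=
      QuotientAddGroup.isOpenQuotientMap_mk.restrictPreimage _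
    rw [hq.isQuotientMap.continuous_iff]
    have h1 : Continuous fun v : (QuotientAddGroup.mk : C2 → C2 ⧸ Γ) ⁻¹' (f.ker : Set (C2 ⧸ Γ)) =>
        (⟨D v, (hmem v).1 v.2⟩ : E.lattice) :=
      Continuous.subtype_mk (D.continuous.comp continuous_subtype_val) _
    refine (continuous_of_discreteTopology (f := ((↑) : E.lattice → E.lattice ⧸ J))).comp h1 |>.congr ?_
    intro v
    exact (hg v v.2).symm
  have hsurj : Function.Surjective g := by
    intro y
    obtain ⟨x, rfl⟩ := QuotientAddGroup.mk_surjective y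
    obtain ⟨v, hv⟩ := LinearMap.surjective hD0 x
    have hv' : D v = x := hv
    have hvk : (v : C2 ⧸ Γ) ∈ f.ker := (hmem v).2 (by rw [hv']; exact x.2)
    refine ⟨⟨v, hvk⟩, ?_⟩
    rw [hg]
    congr 1
    exact Subtype.ext hv'
  have : DiscreteTopology (E.lattice ⧸ J) := QuotientAddGroup.discreteTopology (isOpen_discrete _)
  have hfinite : Finite (E.lattice ⧸ J) := by
    refine Finite.of_surjective hcont.connectedComponentsLift fun y => ?_
    obtain ⟨x, rfl⟩ := hsurj y
    exact ⟨x, hcont.connectedComponentsLift_apply_coe x⟩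
  refine ⟨J.index, AddSubgroup.index_ne_zero_of_finite, fun x hx => ?_⟩
  exact J.nsmul_index_mem (⟨x, hx⟩ : E.lattice)

theorem isogenous_of_line {Γ : AddSubgroup C2} [DiscreteTopology Γ] (hrank : finrank ℤ Γ = 3)
    {E₀ : EllipticCurve} {w : C2} (hw : w ≠ 0) (hE₀ : ∀ z ∈ E₀.lattice, z • w ∈ Γ)
    {E : EllipticCurve} {f : C2 ⧸ Γ →+ E.Points} (hf : IsHolomorphicSurjection Γ E f)
    (hfin : Finite (ConnectedComponents f.ker)) : Isogenous E E₀ := by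
  obtain ⟨D, hD0, hD, hDΓ⟩ := hf.exists_functional
  by_cases hDw : D w = 0
  -- The image of `Γ` has rank at least 2 by finite index, and the kernel contains the rank 2 group
  -- `E₀.lattice • w`; together they exceed 3.
  · exfalso
    obtain ⟨n, hn, hnmem⟩ := exists_nat_smul_mem_map_of_finite_components hD0 hD hfin
    set I := Γ.map (D : C2 →+ ℂ) with hI
    have hIle : I ≤ E.lattice := by
      rintro _ ⟨γ, hγ, rfl⟩
      exact hDΓ γ hγ
    have hdisc : DiscreteTopology I := discreteTopology_of_le E.discrete hIle
    have hle : E.ratSpan ≤ Submodule.span ℚ (I : Set ℂ) := by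
      rw [EllipticCurve.ratSpan, Submodule.span_le]
      intro x hx
      have h1 : (n : ℚ)⁻¹ • (n • x) ∈ Submodule.span ℚ (I : Set ℂ) :=
        Submodule.smul_mem _ _ (Submodule.subset_span (hnmem x hx))
      rwa [← Nat.cast_smul_eq_nsmul ℚ, smul_smul, inv_mul_cancel₀ (Nat.cast_ne_zero.2 hn),
        one_smul] at h1
    have := finite_span_rat I
    have h2 := Submodule.finrank_mono hle
    rw [E.finrank_ratSpan, finrank_span_rat] at h2
    have hK : DiscreteTopology (Γ ⊓ (D : C2 →+ ℂ).ker : AddSubgroup C2) :=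
      discreteTopology_of_le ‹_› inf_le_left
    obtain ⟨b, hb, hspan⟩ := E₀.exists_basis
    have hbmem (i : Fin 2) : b i ∈ E₀.lattice := by
      have : b i ∈ AddSubgroup.toIntSubmodule E₀.lattice := hspan ▸ Submodule.subset_span ⟨i, rfl⟩
      exact this
    have hli : LinearIndependent ℝ fun i => b i • w :=
      hb.map' ((LinearMap.toSpanSingleton ℂ C2 w).restrictScalars ℝ)
        (LinearMap.ker_eq_bot.2 (smul_left_injective ℂ hw))
    have h3 := card_le_finrank_int (Γ ⊓ (D : C2 →+ ℂ).ker) hli (fun i => by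
      refine ⟨hE₀ _ (hbmem i), ?_⟩
      change D (b i • w) = 0
      rw [map_smul, hDw, smul_zero])
    have h4 := finrank_map_add_finrank_inf_ker Γ (D : C2 →+ ℂ)
    rw [Fintype.card_fin] at h3
    rw [← hI] at h4
    omega
  · refine isogenous_of_mul_mem_ratSpan (inv_ne_zero hDw)
      (inv_mul_mem_ratSpan hDw fun z hz => E.mem_ratSpan ?_)
    have := hDΓ _ (hE₀ z hz)
    rwa [map_smul, smul_eq_mul, mul_comm] at this

/-- Any two rational planes in a cubic field are proportional. -/
theorem exists_mul_mem_of_finrank_eq_three {K : Type*} [Field K] [Algebra ℚ K]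
    (hK : finrank ℚ K = 3) {U U' : Submodule ℚ K} (hU : finrank ℚ U = 2)
    (hU' : finrank ℚ U' = 2) : ∃ d : K, d ≠ 0 ∧ ∀ u ∈ U, d * u ∈ U' := by
  have : FiniteDimensional ℚ K := FiniteDimensional.of_finrank_pos (by omega)
  -- A multiplier d is admissible when the map U → K/U' it induces vanishes. These maps form a space
  -- of dimension 2·1, less than 3, so a nonzero d exists.
  let T : K →ₗ[ℚ] U →ₗ[ℚ] K ⧸ U' :=
    ((LinearMap.mul ℚ K).compr₂ U'.mkQ).compl₂ U.subtype
  have hlt : finrank ℚ (U →ₗ[ℚ] K ⧸ U') < finrank ℚ K := by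
    rw [finrank_linearMap, hU, hK]
    have := Submodule.finrank_quotient_add_finrank U'
    omega
  obtain ⟨d, hd, hd0⟩ := Submodule.exists_mem_ne_zero_of_ne_bot
    (LinearMap.ker_ne_bot_of_finrank_lt (f := T) hlt)
  refine ⟨d, hd0, fun u hu => ?_⟩
  have h := LinearMap.congr_fun (LinearMap.mem_ker.1 hd) ⟨u, hu⟩
  simpa [T] using h

/-- Without an elliptic line the ranks of kernel and image on `Γ` must be 1 and 2. A nonzero kernel
vector has coordinates in `k`, so `D` is a constant times a determinant with entries in `k`. -/
theorem exists_plane_of_cubic {Γ : AddSubgroup C2} [DiscreteTopology Γ]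
    (hrank : finrank ℤ Γ = 3) (hline : ¬ HasEllipticLine Γ) {k : IntermediateField ℚ ℂ}
    {A : C2 ≃ₗ[ℂ] C2} (hA : ∀ γ ∈ Γ, ∀ i, A γ i ∈ k)
    {E : EllipticCurve} {f : C2 ⧸ Γ →+ E.Points} (hf : IsHolomorphicSurjection Γ E f) :
    ∃ (c : ℂ) (U : Submodule ℚ k), c ≠ 0 ∧ finrank ℚ U = 2 ∧
      U.map (LinearMap.mulLeft ℚ c ∘ₗ k.val.toLinearMap) = E.ratSpan := by
  obtain ⟨D, hD0, -, hDΓ⟩ := hf.exists_functional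
  set I := Γ.map (D : C2 →+ ℂ) with hI
  have hIle : I ≤ E.lattice := by
    rintro _ ⟨γ, hγ, rfl⟩
    exact hDΓ γ hγ
  have hdisc : DiscreteTopology I := discreteTopology_of_le E.discrete hIle
  have hI2 := finrank_int_le_of_mem_submodule I ⊤ fun _ _ => Submodule.mem_top
  rw [finrank_top, Complex.finrank_real_complex] at hI2
  have hker : ¬ 2 ≤ finrank ℤ (Γ ⊓ (D : C2 →+ ℂ).ker : AddSubgroup C2) :=
    fun h => hline (hasEllipticLine_of_two_le Γ hD0 h)
  have hsum := finrank_map_add_finrank_inf_ker Γ (D : C2 →+ ℂ)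
  rw [hrank, ← hI] at hsum
  have hspan : Submodule.span ℚ (I : Set ℂ) = E.ratSpan := by
    have hle : Submodule.span ℚ (I : Set ℂ) ≤ E.ratSpan := Submodule.span_mono hIle
    apply Submodule.eq_of_le_of_finrank_eq hle
    rw [E.finrank_ratSpan, finrank_span_rat]
    omega
  obtain ⟨γ, hγ, hγ0⟩ : ∃ γ ∈ Γ ⊓ (D : C2 →+ ℂ).ker, γ ≠ 0 := by
    by_contra! h
    have hbot : Γ ⊓ (D : C2 →+ ℂ).ker = ⊥ := (AddSubgroup.eq_bot_iff_forall _).2 h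
    have h0 : finrank ℤ (Γ ⊓ (D : C2 →+ ℂ).ker : AddSubgroup C2) = 0 := by
      rw [hbot, finrank_zero_of_subsingleton]
    omega
  obtain ⟨c, hc⟩ := exists_eq_mul_detLeft ((LinearEquiv.map_ne_zero_iff A).2 hγ0)
    ((D : C2 →ₗ[ℂ] ℂ) ∘ₗ (A.symm : C2 →ₗ[ℂ] C2)) (by
      have : D γ = 0 := hγ.2
      simpa using this)
  have hc' (v : C2) : D v = c * detLeft (A γ) (A v) := by
    rw [← hc]; simp
  have hc0 : c ≠ 0 := by
    rintro rfl
    exact hD0 (LinearMap.ext fun v => by simp [hc'])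
  set ν := LinearMap.mulLeft ℚ c ∘ₗ k.val.toLinearMap with hν
  have hνinj : Function.Injective ν :=
    (mul_right_injective₀ hc0).comp k.val.injective
  have hrange : E.ratSpan ≤ LinearMap.range ν := by
    rw [← hspan, Submodule.span_le]
    rintro _ ⟨γ', hγ', rfl⟩
    refine ⟨⟨detLeft (A γ) (A γ'), ?_⟩, (hc' γ').symm⟩
    rw [detLeft_apply]
    exact k.sub_mem (k.mul_mem (hA γ hγ.1 0) (hA γ' hγ' 1)) (k.mul_mem (hA γ hγ.1 1) (hA γ' hγ' 0))
  have hmap : (E.ratSpan.comap ν).map ν = E.ratSpan := Submodule.map_comap_eq_self hrange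
  refine ⟨c, E.ratSpan.comap ν, hc0, ?_, hmap⟩
  rw [(Submodule.equivMapOfInjective ν hνinj _).finrank_eq, hmap, E.finrank_ratSpan]

theorem exists_isogenous_of_cubic {Γ : AddSubgroup C2} [DiscreteTopology Γ]
    (hrank : finrank ℤ Γ = 3) (hline : ¬ HasEllipticLine Γ) (hcubic : IsCubic Γ) :
    ∃ E₀ : EllipticCurve, ∀ (E : EllipticCurve) (f : C2 ⧸ Γ →+ E.Points),
      IsHolomorphicSurjection Γ E f → Isogenous E E₀ := by
  obtain ⟨k, hk, A, hA⟩ := hcubic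
  by_cases hex : ∃ (E : EllipticCurve) (f : C2 ⧸ Γ →+ E.Points), IsHolomorphicSurjection Γ E f
  · obtain ⟨E₀, f₀, hf₀⟩ := hex
    obtain ⟨c₀, U₀, hc₀, hU₀, hmap₀⟩ := exists_plane_of_cubic hrank hline hA hf₀
    refine ⟨E₀, fun E f hf => ?_⟩
    obtain ⟨c, U, hc, hU, hmap⟩ := exists_plane_of_cubic hrank hline hA hf
    obtain ⟨d, hd, hdU⟩ := exists_mul_mem_of_finrank_eq_three hk hU hU₀
    have hdC : (d : ℂ) ≠ 0 := by simpa using hd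
    refine isogenous_of_mul_mem_ratSpan (c := c₀ * d * c⁻¹)
      (mul_ne_zero (mul_ne_zero hc₀ hdC) (inv_ne_zero hc)) fun x hx => ?_
    have hx' := E.mem_ratSpan hx
    rw [← hmap] at hx'
    obtain ⟨u, hu, rfl⟩ := hx'
    rw [← hmap₀]
    refine ⟨d * u, hdU u hu, ?_⟩
    simp only [LinearMap.comp_apply, LinearMap.mulLeft_apply, AlgHom.toLinearMap_apply, map_mul,
      IntermediateField.coe_val]
    field_simp
  -- There is no elliptic quotient at all, and any curve serves as `E₀`.
  · have hli : LinearIndependent ℝ ![1, Complex.I] :=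
      (linearIndependent_pair_iff one_ne_zero).2 (by simp)
    exact ⟨EllipticCurve.ofPair hli, fun E f hf => (hex ⟨E, f, hf⟩).elim⟩

end SemiTorus

end

theorem mainTheorem1 (Γ : AddSubgroup SemiTorus.C2) [DiscreteTopology Γ]
    (hrank : Module.finrank ℤ Γ = 3) :
    ((∀ (E E' : SemiTorus.EllipticCurve)
        (f : SemiTorus.C2 ⧸ Γ →+ E.Points) (f' : SemiTorus.C2 ⧸ Γ →+ E'.Points),
        SemiTorus.IsHolomorphicSurjection Γ E f →
        IsConnected (f.ker : Set (SemiTorus.C2 ⧸ Γ)) →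
        SemiTorus.IsHolomorphicSurjection Γ E' f' →
        IsConnected (f'.ker : Set (SemiTorus.C2 ⧸ Γ)) →
        SemiTorus.Isogenous E E') →
      SemiTorus.Splits Γ ∨ SemiTorus.IsCubic Γ) ∧
    (SemiTorus.Splits Γ ∨ SemiTorus.IsCubic Γ →
      ∃ E₀ : SemiTorus.EllipticCurve,
        ∀ (E : SemiTorus.EllipticCurve) (f : SemiTorus.C2 ⧸ Γ →+ E.Points),
          SemiTorus.IsHolomorphicSurjection Γ E f →
          (SemiTorus.Splits Γ → Finite (ConnectedComponents f.ker)) →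
          SemiTorus.Isogenous E E₀) := by
  refine ⟨SemiTorus.splits_or_isCubic Γ hrank, fun h => ?_⟩
  -- The condition on components is available exactly when `Γ` splits, so this case comes first even
  -- if `Γ` is also cubic.
  by_cases hsplit : SemiTorus.Splits Γ
  · obtain ⟨E₀, w, hw, hE₀⟩ := hsplit.exists_lattice
    exact ⟨E₀, fun E f hf hfin => SemiTorus.isogenous_of_line hrank hw hE₀ hf (hfin hsplit)⟩
  · obtain ⟨E₀, hE₀⟩ := SemiTorus.exists_isogenous_of_cubic hrank
      (fun hline => hsplit (hline.splits hrank)) (h.resolve_left hsplit)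
    exact ⟨E₀, fun E f hf _ => hE₀ E f hf⟩
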